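/- Let $\mathbb D$ be the open unit disk. A set $\Lambda\subset\mathbb D$ is called discrete if it is at most countable and has no accumulation points in $\mathbb D$. For a complex-valued function $f$ defined on $\mathrm{Dom}(f)=\mathbb D\setminus\Lambda$, with $\Lambda$ discrete, and distinct points $y_1,\dots,y_n\in\mathrm{Dom}(f)$, the Pick matrix is $$P_n(f;y_1,\dots,y_n)=\left[\frac{1-f(y_i)\overline{f(y_j)}}{1-y_i\overline{y_j}}\right]_{i,j=1}^n .$$ Let $\mathrm{sq}_-P$ be the number of negative eigenvalues, counted with multiplicities, of a Hermitian matrix $P$. The function $f$ belongs to the class $\mathcal S_\kappa$ if all its Pick matrices satisfy $\mathrm{sq}_-\le\kappa$ and equality holds for at least one of them. Let $\mathbf k_n(f)$ be the maximum of $\mathrm{sq}_-P_n(f;y_1,\dots,y_n)$ over all Pick matrices of order $n$ of $f$, with $\mathbf k_0(f)=0$, and for $f\in\mathcal S_\kappa$ let $N(f)=\min\{n\ge 0:\mathbf k_n(f)=\kappa\}$. A Schur function is an analytic function $S$ on $\mathbb D$ with $|S|\le1$ on $\mathbb D$; a (finite) Blaschke product is a rational function that is analytic on $\mathbb D$ and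 unimodular on the unit circle, and its degree is the number of its zeros in $\mathbb D$, counted with multiplicities. For a function $g$ on $\mathbb D$ let $Z(g)$ be its zero set in $\mathbb D$. A standard function with $q$ poles and $\ell$ jumps is a function $f$ with $\mathrm{Dom}(f)=\mathbb D\setminus\mathcal W$ of the form $$f(z)=\frac{S(z)}{B(z)}\quad (z\notin\mathcal W\cup\mathcal Z),\qquad f(z_j)=\gamma_j\quad(j=1,\dots,\ell),$$ where $\mathcal Z=\{z_1,\dots,z_\ell\}$ consists of $\ell$ distinct points of $\mathbb D$ (the jumps), $\mathcal W$ is a finite subset of $\mathbb D$ disjoint from $\mathcal Z$, $\gamma_1,\dots,\gamma_\ell\in\mathbb C$, $S$ is a Schur function, $B$ is a Blaschke product of degree $q$, $\mathcal W\subseteq Z(B)\subseteq\mathcal W\cup\mathcal Z$, $Z(B)\cap Z(S)=\emptyset$, and $S(z_j)/B(z_j)\ne\gamma_j$ whenever $z_j\notin Z(B)$. Its poles are the zeros of $B$ in $\mathbb D$, with their multiplicities. **Theorem.** Let $f$ be a standard function with $q$ poles and $\ell$ jumps $z_1,\dots,z_\ell$. Then $f\in\mathcal S_{q+\ell}$,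 and $$q+\ell\le N(f)\le q+2\ell .$$ Moreover, let $w_1,\dots,w_k$ be the distinct poles of $f$, with multiplicities $r_1,\dots,r_k$. Then there is an $\epsilon>0$ such that every set $Y=\{y_1,\dots,y_m\}$ of $m=q+2\ell$ distinct points satisfying conditions 1–3 below is contained in $\mathrm{Dom}(f)$ and satisfies $$\mathrm{sq}_-P_m(f;y_1,\dots,y_m)=q+\ell .$$ 1. $\ell$ points of $Y$ coincide with $z_1,\dots,z_\ell$; 2. $\ell$ further points $\nu_1,\dots,\nu_\ell$ of $Y$, different from $z_1,\dots,z_\ell$, satisfy $|\nu_j-z_j|<\epsilon$ for $j=1,\dots,\ell$; 3. the remaining $q$ points of $Y$ are distributed over $k$ disjoint subsets $Y_1,\dots,Y_k$ such that $Y_j$ consists of $r_j$ points, all at a positive distance less than $\epsilon$ from $w_j$, for $j=1,\dots,k$. -/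

import Mathlib

open Set Metric ComplexConjugate
open scoped Topology

noncomputable section

/-- The open unit disk of the complex plane. -/
def unitDisk : Set ℂ := ball (0 : ℂ) 1

/-- `Λ` is a discrete subset of the disk: at most countable, with accumulation points (if any) only
on the boundary of the disk. -/
def IsDiscreteInDisk (Λ : Set ℂ) : Prop :=
  Λ ⊆ unitDisk ∧ Λ.Countable ∧ ∀ x ∈ unitDisk, ¬ AccPt x (Filter.principal Λ)

/-- The domain of definition `𝔻 \ Λ`. A function defined on `𝔻 \ Λ` is represented by a function
`f : ℂ → ℂ` of which only the values on `dom Λ` are used. -/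
def dom (Λ : Set ℂ) : Set ℂ := unitDisk \ Λ

/-- The Pick matrix `[(1 - f(y i) f(y j)^*) / (1 - (y i) (y j)^*)]`. -/
def pickMatrix {n : ℕ} (f : ℂ → ℂ) (y : Fin n → ℂ) : Matrix (Fin n) (Fin n) ℂ :=
  Matrix.of fun i j => (1 - f (y i) * conj (f (y j))) / (1 - y i * conj (y j))

theorem pickMatrix_isHermitian {n : ℕ} (f : ℂ → ℂ) (y : Fin n → ℂ) :
    (pickMatrix f y).IsHermitian := by
  ext i j
  simp [pickMatrix, Matrix.conjTranspose_apply, mul_comm]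

/-- The number of negative eigenvalues, counted with multiplicities, of a Hermitian matrix. -/
def negEig {n : ℕ} {P : Matrix (Fin n) (Fin n) ℂ} (hP : P.IsHermitian) : ℕ :=
  (Finset.univ.filter fun i => hP.eigenvalues i < 0).card

/-- The number of negative eigenvalues of the Pick matrix of `f` at the points `y`. -/
def pickNeg {n : ℕ} (f : ℂ → ℂ) (y : Fin n → ℂ) : ℕ :=
  negEig (pickMatrix_isHermitian f y)

/-- `f`, defined on `𝔻 \ Λ`, belongs to the class `𝒮_κ`. -/
structure ClassS (κ : ℕ) (Λ : Set ℂ) (f : ℂ → ℂ) : Prop where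
  discrete : IsDiscreteInDisk Λ
  le : ∀ (n : ℕ) (y : Fin n → ℂ), Function.Injective y → (∀ i, y i ∈ dom Λ) → pickNeg f y ≤ κ
  attained : ∃ (n : ℕ) (y : Fin n → ℂ), 0 < n ∧ Function.Injective y ∧ (∀ i, y i ∈ dom Λ) ∧
    pickNeg f y = κ

/-- `𝐤_n(f)`: the maximal number of negative eigenvalues of the Pick matrices of order `n` of `f`.
The set is bounded by `n`, and `𝐤_0(f) = 0`. -/
def maxNeg (Λ : Set ℂ) (f : ℂ → ℂ) (n : ℕ) : ℕ :=
  sSup {k : ℕ | ∃ y : Fin n → ℂ, Function.Injective y ∧ (∀ i, y i ∈ dom Λ) ∧ k = pickNeg f y}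

/-- `N(f)`, for `f` in the class `𝒮_κ`: the least `n` such that `𝐤_n(f) = κ`. -/
def minOrder (κ : ℕ) (Λ : Set ℂ) (f : ℂ → ℂ) : ℕ :=
  sInf {n : ℕ | maxNeg Λ f n = κ}

/-- Schur functions: analytic on the disk and bounded by one there. -/
def IsSchur (S : ℂ → ℂ) : Prop :=
  AnalyticOnNhd ℂ S unitDisk ∧ ∀ z ∈ unitDisk, ‖S z‖ ≤ 1

/-- The value of a rational function at a point (it is `0` at a pole). -/
def ratVal (B : RatFunc ℂ) (z : ℂ) : ℂ := RatFunc.eval (RingHom.id ℂ) z B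

/-- (Finite) Blaschke products: rational functions analytic on the disk (that is, without poles
there) and unimodular on the unit circle. -/
def IsBlaschke (B : RatFunc ℂ) : Prop :=
  (∀ z ∈ unitDisk, B.denom.eval z ≠ 0) ∧ ∀ z : ℂ, ‖z‖ = 1 → ‖ratVal B z‖ = 1

/-- The zero set in the disk. -/
def diskZeros (g : ℂ → ℂ) : Set ℂ := {z | z ∈ unitDisk ∧ g z = 0}

/-- The multiplicity of `w` as a zero of a rational function (`num` and `denom` are coprime). -/
def zeroMult (B : RatFunc ℂ) (w : ℂ) : ℕ := B.num.rootMultiplicity w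

open Classical in
/-- The degree of a Blaschke product: the number of its zeros in the disk, counted with
multiplicities. -/
def blaschkeDegree (B : RatFunc ℂ) : ℕ :=
  (B.num.roots.filter fun z => z ∈ unitDisk).card

/-- `f` is the standard function with domain `𝔻 \ W` that is given by `S / B` off `W ∪ {z_j}` and
by the values `γ_j` at the jumps `z_j`; it has `q` poles, the zeros of `B` counted with
multiplicities, and `ℓ` jumps. -/
structure IsStandard (q ℓ : ℕ) (W : Finset ℂ) (f S : ℂ → ℂ) (B : RatFunc ℂ)
    (z γ : Fin ℓ → ℂ) : Prop where
  z_inj : Function.Injective z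
  z_mem : ∀ j, z j ∈ unitDisk
  W_subset : (W : Set ℂ) ⊆ unitDisk
  disjoint : Disjoint (W : Set ℂ) (range z)
  schur : IsSchur S
  blaschke : IsBlaschke B
  degree : blaschkeDegree B = q
  W_subset_zeros : (W : Set ℂ) ⊆ diskZeros (ratVal B)
  zeros_subset : diskZeros (ratVal B) ⊆ (W : Set ℂ) ∪ range z
  no_common_zeros : diskZeros (ratVal B) ∩ diskZeros S = ∅
  jump : ∀ j, z j ∉ diskZeros (ratVal B) → S (z j) / ratVal B (z j) ≠ γ j
  eq_quotient : ∀ x ∈ unitDisk, x ∉ (W : Set ℂ) ∪ range z → f x = S x / ratVal B x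
  eq_jump : ∀ j, f (z j) = γ j

end

/-! In the Hardy space with Szegő kernels `k_w`, the Pick form is `‖∑ conj (c i) k_{y i}‖² - ‖∑ conj
(c i * f (y i)) k_{y i}‖²`, so the theorem compares two values of `szegoForm`.

At most `q + ℓ` negative squares (`IsStandard.pickNeg_le`): let `c` vanish at the jumps (`ℓ`
conditions) and, with `d = c / B`, let `∑ conj (d i) k_{y i}` lie in `B H²` (`q` conditions).
Passing from `d` to `d * B = c` then preserves the norm, while passing from `d` to `d * S = c * f`
does not increase it. The form is thus nonnegative on a subspace of codimension at most `q + ℓ`.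

At least `q + ℓ` (`eventually_szegoForm_lt`): take the `ℓ` jumps and `q + ℓ` nodes `x b` near the
jumps and the poles, which together form a list `a` with multiplicities. Put `e b * B (x b)` at the
nodes, and at the jumps the coefficients that cancel Lagrange interpolants. The first norm then
involves only values at the nodes of multiples of `∏ (w - a i)`, which are nearly zero. The second
does not degenerate, since `S` is nonzero at the poles and `S ≠ γ B` at the jumps. Both are compared
with the moments `∑ e b * x b ^ i`, `i < q + ℓ`, because estimates in terms of them stay uniform
when nodes coalesce. The form is negative for all `e ≠ 0`.

The bound `q + ℓ ≤ N(f)` holds because a matrix of order `n` has at most `n` eigenvalues. -/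

/-! ### Negative eigenvalues and subspaces. -/

open Matrix in
theorem re_form_eigenvectorUnitary_mulVec {n : ℕ} {P : Matrix (Fin n) (Fin n) ℂ}
    (hP : P.IsHermitian) (x : Fin n → ℂ) :
    (star ((hP.eigenvectorUnitary : Matrix (Fin n) (Fin n) ℂ) *ᵥ x) ⬝ᵥ
      P *ᵥ ((hP.eigenvectorUnitary : Matrix (Fin n) (Fin n) ℂ) *ᵥ x)).re =
      ∑ i, hP.eigenvalues i * ‖x i‖ ^ 2 := by
  set U : Matrix (Fin n) (Fin n) ℂ := hP.eigenvectorUnitary.1 with hU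
  have hd := hP.conjStarAlgAut_star_eigenvectorUnitary
  rw [Unitary.conjStarAlgAut_star_apply] at hd
  have hd' : Uᴴ * P * U = Matrix.diagonal (RCLike.ofReal ∘ hP.eigenvalues) := by
    rw [← hd]; simp [hU, star_eq_conjTranspose]
  rw [star_mulVec, ← dotProduct_mulVec, mulVec_mulVec, mulVec_mulVec, hd',
    dotProduct, Complex.re_sum]
  refine Finset.sum_congr rfl fun i _ => ?_
  rw [mulVec_diagonal, ← Complex.normSq_eq_norm_sq]
  simp [Complex.normSq_apply]
  ring

open Matrix in
-- The span of the eigenvectors with negative eigenvalues meets the kernel of `L` only in zero, so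
-- `L` is injective on it.
theorem negEig_le_of_nonneg_on_ker {n : ℕ} {κ : Type*} [Fintype κ] {P : Matrix (Fin n) (Fin n) ℂ}
    (hP : P.IsHermitian) (L : (Fin n → ℂ) →ₗ[ℂ] (κ → ℂ))
    (h : ∀ x, L x = 0 → 0 ≤ (star x ⬝ᵥ P *ᵥ x).re) : negEig hP ≤ Fintype.card κ := by
  classical
  set I := {i // hP.eigenvalues i < 0}
  let ext : (I → ℂ) →ₗ[ℂ] (Fin n → ℂ) :=
    { toFun := fun d i => if hi : hP.eigenvalues i < 0 then d ⟨i, hi⟩ else 0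
      map_add' := by intro a b; ext i; by_cases hi : hP.eigenvalues i < 0 <;> simp [hi]
      map_smul' := by intro a b; ext i; by_cases hi : hP.eigenvalues i < 0 <;> simp [hi] }
  let T : (I → ℂ) →ₗ[ℂ] (κ → ℂ) := L ∘ₗ (mulVecLin (hP.eigenvectorUnitary : Matrix _ _ ℂ)) ∘ₗ ext
  have hT : Function.Injective T := by
    rw [← LinearMap.ker_eq_bot, LinearMap.ker_eq_bot']
    intro d hd
    have h1 := h _ hd
    rw [LinearMap.comp_apply, mulVecLin_apply, re_form_eigenvectorUnitary_mulVec] at h1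
    have h2 : ∀ i, hP.eigenvalues i * ‖ext d i‖ ^ 2 ≤ 0 := by
      intro i
      by_cases hi : hP.eigenvalues i < 0
      · exact mul_nonpos_of_nonpos_of_nonneg hi.le (by positivity)
      · simp [ext, hi]
    have h3 := (Finset.sum_eq_zero_iff_of_nonpos fun i _ => h2 i).1
      (le_antisymm (Finset.sum_nonpos fun i _ => h2 i) h1)
    ext ⟨i, hi⟩
    have h4 := h3 i (Finset.mem_univ i)
    simpa [ext, hi, hi.ne] using h4
  have h5 := LinearMap.finrank_le_finrank_of_injective hT
  simpa [negEig, I, Fintype.card_subtype] using h5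

open Matrix in
-- Taking the coordinates along the negative eigenvectors is injective after `Φ`: a vector without
-- such coordinates has a nonnegative form.
theorem card_le_negEig_of_neg {n : ℕ} {ι : Type*} [Fintype ι] {P : Matrix (Fin n) (Fin n) ℂ}
    (hP : P.IsHermitian) (Φ : (ι → ℂ) →ₗ[ℂ] (Fin n → ℂ))
    (h : ∀ e, e ≠ 0 → (star (Φ e) ⬝ᵥ P *ᵥ Φ e).re < 0) : Fintype.card ι ≤ negEig hP := by
  classical
  set I := {i // hP.eigenvalues i < 0}
  set U : Matrix (Fin n) (Fin n) ℂ := hP.eigenvectorUnitary.1 with hU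
  let T : (ι → ℂ) →ₗ[ℂ] (I → ℂ) :=
    LinearMap.funLeft ℂ ℂ (Subtype.val) ∘ₗ (mulVecLin (star U)) ∘ₗ Φ
  have hT : Function.Injective T := by
    rw [← LinearMap.ker_eq_bot, LinearMap.ker_eq_bot']
    intro e he
    by_contra hne
    have h1 := h e hne
    have h2 : Φ e = U *ᵥ (star U *ᵥ Φ e) := by
      rw [mulVec_mulVec]; simp [hU]
    rw [h2, hU, re_form_eigenvectorUnitary_mulVec] at h1
    refine absurd h1 (not_lt.2 (Finset.sum_nonneg fun i _ => ?_))
    by_cases hi : hP.eigenvalues i < 0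
    · have h3 := congrFun he ⟨i, hi⟩
      have h4 : (star U *ᵥ Φ e) i = 0 := by simpa [T, LinearMap.funLeft_apply] using h3
      rw [← hU, h4]; simp
    · exact mul_nonneg (not_lt.1 hi) (by positivity)
  have h5 := LinearMap.finrank_le_finrank_of_injective hT
  simpa [negEig, I, Fintype.card_subtype] using h5

/-! ### The Pick form as a difference of Hardy space norms. -/

/-- The squared norm of `∑ conj (g i) k_{y i}` in the Hardy space, `k_w` being the Szegő kernel. -/
noncomputable def szegoForm {ι : Type*} [Fintype ι] (y g : ι → ℂ) : ℝ :=
  (∑ i, ∑ j, g i * conj (g j) / (1 - y i * conj (y j))).re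

open Matrix in
theorem re_form_pickMatrix {n : ℕ} (f : ℂ → ℂ) (y x : Fin n → ℂ) :
    (star x ⬝ᵥ pickMatrix f y *ᵥ x).re =
      szegoForm y (star x) - szegoForm y (fun i => star x i * f (y i)) := by
  rw [szegoForm, szegoForm, ← Complex.sub_re, ← Finset.sum_sub_distrib]
  congr 1
  rw [dotProduct]
  refine Finset.sum_congr rfl fun i _ => ?_
  rw [mulVec, dotProduct, Finset.mul_sum, ← Finset.sum_sub_distrib]
  refine Finset.sum_congr rfl fun j _ => ?_
  simp [pickMatrix]
  ring

/-- The geometric expansion of the kernel writes the form through power moments; the estimates for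
the lower bound are made on these. -/
theorem szegoForm_hasSum {ι : Type*} [Fintype ι] (y g : ι → ℂ) (hy : ∀ i, y i ∈ unitDisk) :
    HasSum (fun k : ℕ => ‖∑ i, g i * y i ^ k‖ ^ 2) (szegoForm y g) := by
  have h1 : ∀ i j, HasSum (fun k : ℕ => g i * conj (g j) * (y i * conj (y j)) ^ k)
      (g i * conj (g j) / (1 - y i * conj (y j))) := by
    intro i j
    have h4 : ‖y i * conj (y j)‖ < 1 := by
      have h2 := hy i
      have h3 := hy j
      simp only [unitDisk, mem_ball_zero_iff] at h2 h3
      rw [norm_mul, RCLike.norm_conj]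
      nlinarith [norm_nonneg (y i), norm_nonneg (y j)]
    have h5 := (hasSum_geometric_of_norm_lt_one h4).mul_left (g i * conj (g j))
    rwa [← div_eq_mul_inv] at h5
  have h2 : HasSum (fun k : ℕ => ∑ i, ∑ j, g i * conj (g j) * (y i * conj (y j)) ^ k)
      (∑ i, ∑ j, g i * conj (g j) / (1 - y i * conj (y j))) :=
    hasSum_sum fun i _ => hasSum_sum fun j _ => h1 i j
  have h3 : ∀ k : ℕ, ((∑ i, ∑ j, g i * conj (g j) * (y i * conj (y j)) ^ k)).re =
      ‖∑ i, g i * y i ^ k‖ ^ 2 := by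
    intro k
    have h4 : ∑ i, ∑ j, g i * conj (g j) * (y i * conj (y j)) ^ k =
        (∑ i, g i * y i ^ k) * conj (∑ i, g i * y i ^ k) := by
      rw [map_sum, Finset.sum_mul_sum]
      refine Finset.sum_congr rfl fun i _ => Finset.sum_congr rfl fun j _ => ?_
      rw [map_mul, map_pow, mul_pow]
      ring
    rw [h4, Complex.mul_conj, Complex.ofReal_re, Complex.normSq_eq_norm_sq]
  have h5 := Complex.hasSum_re h2
  simp only [h3] at h5
  exact h5

theorem negEig_le_card {n : ℕ} {P : Matrix (Fin n) (Fin n) ℂ} (hP : P.IsHermitian) :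
    negEig hP ≤ n := by
  simpa [negEig] using Finset.card_filter_le Finset.univ fun i => hP.eigenvalues i < 0

/-! ### Positivity of the de Branges–Rovnyak kernel. -/

/-- The function `∑ conj (a i) k_{y i}`, `k_w` being the Szegő kernel. -/
noncomputable def szegoSum {ι : Type*} [Fintype ι] (y a : ι → ℂ) (ζ : ℂ) : ℂ :=
  ∑ i, conj (a i) / (1 - conj (y i) * ζ)

theorem one_sub_conj_mul_ne_zero {w ζ : ℂ} (hw : ‖w‖ < 1) (hζ : ‖ζ‖ ≤ 1) :
    1 - conj w * ζ ≠ 0 := by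
  intro h
  have h1 : conj w * ζ = 1 := (sub_eq_zero.1 h).symm
  have h2 : ‖conj w * ζ‖ = 1 := by rw [h1]; simp
  rw [norm_mul, RCLike.norm_conj] at h2
  nlinarith [norm_nonneg w, norm_nonneg ζ]

theorem szegoSum_differentiableAt {ι : Type*} [Fintype ι] {y : ι → ℂ} (a : ι → ℂ)
    (hy : ∀ i, y i ∈ unitDisk) {ζ : ℂ} (hζ : ‖ζ‖ ≤ 1) :
    DifferentiableAt ℂ (szegoSum y a) ζ := by
  unfold szegoSum
  refine DifferentiableAt.fun_sum fun i _ => ?_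
  refine (differentiableAt_const _).div (by fun_prop) ?_
  exact one_sub_conj_mul_ne_zero (by simpa [unitDisk] using hy i) hζ

theorem szegoSum_diffContOnCl {ι : Type*} [Fintype ι] {y : ι → ℂ} (a : ι → ℂ)
    (hy : ∀ i, y i ∈ unitDisk) : DiffContOnCl ℂ (szegoSum y a) (ball 0 1) := by
  refine DifferentiableOn.diffContOnCl fun ζ hζ => ?_
  rw [closure_ball (0 : ℂ) one_ne_zero, mem_closedBall_zero_iff] at hζ
  exact (szegoSum_differentiableAt a hy hζ).differentiableWithinAt

theorem continuousOn_sphere_of_diffContOnCl {F : ℂ → ℂ} (hF : DiffContOnCl ℂ F (ball 0 1)) :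
    ContinuousOn F (sphere 0 1) :=
  hF.continuousOn.mono (by rw [closure_ball (0 : ℂ) one_ne_zero]; exact sphere_subset_closedBall)

theorem circleIntegrable_mul_conj {F G : ℂ → ℂ} (hF : DiffContOnCl ℂ F (ball 0 1))
    (hG : DiffContOnCl ℂ G (ball 0 1)) : CircleIntegrable (fun ζ => F ζ * conj (G ζ)) 0 1 := by
  refine ContinuousOn.circleIntegrable zero_le_one ?_
  exact (continuousOn_sphere_of_diffContOnCl hF).mul
    (Complex.continuous_conj.comp_continuousOn (continuousOn_sphere_of_diffContOnCl hG))

/-- This is the reproducing property: on the circle `conj ζ = ζ⁻¹` turns the conjugated Szegő kernel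
into `ζ / (ζ - y i)`, and Cauchy's formula applies. -/
theorem circleAverage_mul_conj_szegoSum {ι : Type*} [Fintype ι] {y : ι → ℂ} (a : ι → ℂ)
    (hy : ∀ i, y i ∈ unitDisk) {F : ℂ → ℂ} (hF : DiffContOnCl ℂ F (ball 0 1)) :
    Real.circleAverage (fun ζ => F ζ * conj (szegoSum y a ζ)) 0 1 = ∑ i, a i * F (y i) := by
  have h1 : ∀ i, Real.circleAverage (fun ζ => ((ζ - 0) / (ζ - y i)) • F ζ) 0 1 = F (y i) := by
    intro i
    refine DiffContOnCl.circleAverage_smul_div (by simpa using hF) ?_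
    simpa [unitDisk] using hy i
  have hne : ∀ i, ∀ ζ ∈ sphere (0 : ℂ) 1, ζ - y i ≠ 0 := by
    intro i ζ hζ h
    have := hy i
    rw [← sub_eq_zero.1 h] at this
    simp only [unitDisk, mem_ball_zero_iff, mem_sphere_zero_iff_norm] at this hζ
    linarith
  have h2 : EqOn (fun ζ => F ζ * conj (szegoSum y a ζ))
      (fun ζ => ∑ i, a i • (((ζ - 0) / (ζ - y i)) • F ζ)) (sphere 0 |1|) := by
    intro ζ hζ
    rw [abs_one] at hζ
    simp only [szegoSum, map_sum, Finset.mul_sum]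
    refine Finset.sum_congr rfl fun i _ => ?_
    have h3 := hne i ζ hζ
    have h4 : ζ * conj ζ = 1 := by
      rw [Complex.mul_conj, Complex.normSq_eq_norm_sq, mem_sphere_zero_iff_norm.1 hζ]; simp
    have h5 : 1 - y i * conj ζ = (ζ - y i) * conj ζ := by rw [sub_mul, h4]
    have h6 : conj ζ ≠ 0 := by rintro h; simp [h] at h4
    simp only [map_div₀, map_sub, map_one, map_mul, Complex.conj_conj, smul_eq_mul, sub_zero, h5]
    field_simp
    linear_combination (-F ζ * a i) * h4
  rw [Real.circleAverage_congr_sphere h2, Real.circleAverage_fun_sum]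
  · refine Finset.sum_congr rfl fun i _ => ?_
    rw [Real.circleAverage_fun_smul, h1, smul_eq_mul]
  · intro i _
    refine ContinuousOn.circleIntegrable zero_le_one ?_
    have h3 : ContinuousOn (fun ζ => (ζ - 0) / (ζ - y i)) (sphere 0 1) :=
      ContinuousOn.div (by fun_prop) (by fun_prop) (hne i)
    exact (h3.smul (continuousOn_sphere_of_diffContOnCl hF)).const_smul (a i)

theorem sum_mul_szegoSum_re {ι : Type*} [Fintype ι] (y a : ι → ℂ) :
    (∑ i, a i * szegoSum y a (y i)).re = szegoForm y a := by
  rw [szegoForm]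
  congr 1
  refine Finset.sum_congr rfl fun i _ => ?_
  rw [szegoSum, Finset.mul_sum]
  refine Finset.sum_congr rfl fun j _ => ?_
  rw [mul_comm (y i), mul_div_assoc]

/-- Positivity of the de Branges–Rovnyak kernel of a function that is continuous up to the
circle. -/
theorem szegoForm_mul_le_of_diffContOnCl {ι : Type*} [Fintype ι] {y : ι → ℂ} (a : ι → ℂ)
    (hy : ∀ i, y i ∈ unitDisk) {S : ℂ → ℂ} (hS : DiffContOnCl ℂ S (ball 0 1))
    (hS1 : ∀ ζ, ‖ζ‖ = 1 → ‖S ζ‖ ≤ 1) :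
    szegoForm y (fun i => a i * S (y i)) ≤ szegoForm y a := by
  set b : ι → ℂ := fun i => a i * S (y i) with hb
  set g := szegoSum y a
  set h := szegoSum y b
  have hg : DiffContOnCl ℂ g (ball 0 1) := szegoSum_diffContOnCl a hy
  have hh : DiffContOnCl ℂ h (ball 0 1) := szegoSum_diffContOnCl b hy
  have hSh : DiffContOnCl ℂ (fun ζ => S ζ * h ζ) (ball 0 1) := hS.smul hh
  set F1 : ℂ → ℂ := fun ζ => g ζ * conj (g ζ)
  set F2 : ℂ → ℂ := fun ζ => h ζ * conj (h ζ)
  set F3 : ℂ → ℂ := fun ζ => S ζ * h ζ * conj (g ζ)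
  have e1 : Real.circleAverage F1 0 1 = _ := circleAverage_mul_conj_szegoSum a hy hg
  have e2 : Real.circleAverage F2 0 1 = _ := circleAverage_mul_conj_szegoSum b hy hh
  have e3 : Real.circleAverage F3 0 1 = _ := circleAverage_mul_conj_szegoSum a hy hSh
  have i1 : CircleIntegrable F1 0 1 := circleIntegrable_mul_conj hg hg
  have i2 : CircleIntegrable F2 0 1 := circleIntegrable_mul_conj hh hh
  have i3 : CircleIntegrable F3 0 1 := circleIntegrable_mul_conj hSh hg
  -- `Re Ψ = ‖S h - g‖² + (1 - ‖S‖²) ‖h‖²` on the circle. By the reproducing property `F2` and `F3`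
  -- have equal averages, so the average of `Ψ` has real part `‖g‖² - ‖h‖²`.
  set Ψ : ℂ → ℂ := F2 + F1 - (2 : ℂ) • F3 with hΨ
  have i4 : CircleIntegrable Ψ 0 1 := (i2.add i1).sub i3.const_smul
  have e4 : Real.circleAverage Ψ 0 1 = (∑ i, b i * h (y i)) + (∑ i, a i * g (y i)) -
      2 * ∑ i, b i * h (y i) := by
    rw [hΨ, Real.circleAverage_sub (i2.add i1) i3.const_smul, Real.circleAverage_add i2 i1,
      Real.circleAverage_smul, e1, e2, e3, smul_eq_mul]
    simp only [hb, mul_assoc]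
  have e5 : (Real.circleAverage Ψ 0 1).re = Real.circleAverage (fun ζ => (Ψ ζ).re) 0 1 :=
    (Complex.reCLM.circleAverage_comp_comm i4).symm
  have e6 : 0 ≤ Real.circleAverage (fun ζ => (Ψ ζ).re) 0 1 := by
    refine Real.circleAverage_nonneg_of_nonneg fun ζ hζ => ?_
    have h1 := hS1 ζ (by simpa using hζ)
    have h2 : (Ψ ζ).re = ‖h ζ‖ ^ 2 * (1 - ‖S ζ‖ ^ 2) + ‖S ζ * h ζ - g ζ‖ ^ 2 := by
      rw [hΨ]
      simp only [F1, F2, F3, Pi.sub_apply, Pi.add_apply, Pi.smul_apply, ← Complex.normSq_eq_norm_sq, Complex.normSq_apply, smul_eq_mul, Complex.sub_re,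
        Complex.add_re, Complex.mul_re, Complex.mul_im, Complex.sub_im, Complex.conj_re,
        Complex.conj_im, Complex.re_ofNat, Complex.im_ofNat]
      ring
    show 0 ≤ (Ψ ζ).re
    rw [h2]
    have h3 : ‖S ζ‖ ^ 2 ≤ 1 := by nlinarith [norm_nonneg (S ζ)]
    have h4 : 0 ≤ 1 - ‖S ζ‖ ^ 2 := by linarith
    positivity
  rw [← e5, e4, Complex.sub_re, Complex.add_re, sum_mul_szegoSum_re, sum_mul_szegoSum_re,
    Complex.mul_re, sum_mul_szegoSum_re] at e6
  simp at e6
  linarith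

/-- Positivity of the de Branges–Rovnyak kernel of a Schur function. -/
theorem IsSchur.szegoForm_mul_le {ι : Type*} [Fintype ι] {y : ι → ℂ} (a : ι → ℂ)
    (hy : ∀ i, y i ∈ unitDisk) {S : ℂ → ℂ} (hS : IsSchur S) :
    szegoForm y (fun i => a i * S (y i)) ≤ szegoForm y a := by
  -- The dilation `S (r ζ)` is analytic across the circle; the general case is the limit `r → 1`.
  have h1 : ∀ r ∈ Ioo (0 : ℝ) 1,
      szegoForm y (fun i => a i * S (r * y i)) ≤ szegoForm y a := by
    intro r hr
    have hmem : ∀ ζ : ℂ, ‖ζ‖ ≤ 1 → (r : ℂ) * ζ ∈ unitDisk := by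
      intro ζ hζ
      rw [unitDisk, mem_ball_zero_iff, norm_mul, Complex.norm_real, Real.norm_of_nonneg hr.1.le]
      nlinarith [hr.1, hr.2, norm_nonneg ζ]
    refine szegoForm_mul_le_of_diffContOnCl (S := fun ζ => S (r * ζ)) a hy ?_ ?_
    · refine DifferentiableOn.diffContOnCl fun ζ hζ => ?_
      rw [closure_ball (0 : ℂ) one_ne_zero, mem_closedBall_zero_iff] at hζ
      refine DifferentiableAt.differentiableWithinAt ?_
      exact (hS.1 _ (hmem ζ hζ)).differentiableAt.fun_comp' ζ (by fun_prop)
    · exact fun ζ hζ => hS.2 _ (hmem ζ hζ.le)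
  have h2 : Filter.Tendsto (fun r : ℝ => szegoForm y (fun i => a i * S (r * y i))) (𝓝[<] 1)
      (𝓝 (szegoForm y (fun i => a i * S (y i)))) := by
    have h3 : ∀ i, Filter.Tendsto (fun r : ℝ => S (r * y i)) (𝓝[<] 1) (𝓝 (S (y i))) := by
      intro i
      have h4 : ContinuousAt (fun r : ℝ => S (r * y i)) 1 := by
        have h5 : ContinuousAt S (((1 : ℝ) : ℂ) * y i) := by
          simpa using (hS.1 _ (hy i)).continuousAt
        exact ContinuousAt.comp (f := fun r : ℝ => (r : ℂ) * y i) (g := S) h5 (by fun_prop)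
      simpa [ContinuousAt] using h4.tendsto.mono_left (nhdsWithin_le_nhds (s := Iio 1))
    unfold szegoForm
    refine (Complex.continuous_re.tendsto _).comp ?_
    refine tendsto_finsetSum _ fun i _ => tendsto_finsetSum _ fun j _ => ?_
    refine Filter.Tendsto.div_const ?_ _
    refine ((h3 i).const_mul _).mul ?_
    exact (Complex.continuous_conj.tendsto _).comp ((h3 j).const_mul _)
  refine le_of_tendsto h2 ?_
  filter_upwards [Ioo_mem_nhdsLT (zero_lt_one' ℝ)] with r hr using h1 r hr

theorem pickNeg_le_of_nonneg_on_ker {n : ℕ} {κ : Type*} [Fintype κ] (f : ℂ → ℂ) (y : Fin n → ℂ)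
    (L : (Fin n → ℂ) →ₗ[ℂ] (κ → ℂ))
    (h : ∀ c, L c = 0 → szegoForm y (fun i => c i * f (y i)) ≤ szegoForm y c) :
    pickNeg f y ≤ Fintype.card κ := by
  -- The Pick form at `x` is expressed through `star x`; conjugating before and after `L` keeps the
  -- map complex linear.
  let L' : (Fin n → ℂ) →ₗ[ℂ] (κ → ℂ) :=
    { toFun := fun x => star (L (star x))
      map_add' := by intro a b; simp
      map_smul' := by intro a b; simp [star_smul] }
  refine negEig_le_of_nonneg_on_ker (pickMatrix_isHermitian f y) L' fun x hx => ?_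
  rw [re_form_pickMatrix, sub_nonneg]
  exact h (star x) (star_eq_zero.1 hx)

theorem card_le_pickNeg_of_neg {n : ℕ} {ι : Type*} [Fintype ι] (f : ℂ → ℂ) (y : Fin n → ℂ)
    (Φ : (ι → ℂ) →ₗ[ℂ] (Fin n → ℂ))
    (h : ∀ e, e ≠ 0 → szegoForm y (Φ e) < szegoForm y (fun i => Φ e i * f (y i))) :
    Fintype.card ι ≤ pickNeg f y := by
  let Φ' : (ι → ℂ) →ₗ[ℂ] (Fin n → ℂ) :=
    { toFun := fun x => star (Φ (star x))
      map_add' := by intro a b; simp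
      map_smul' := by intro a b; simp [star_smul] }
  refine card_le_negEig_of_neg (pickMatrix_isHermitian f y) Φ' fun e he => ?_
  rw [re_form_pickMatrix, sub_neg]
  have := h (star e) (by simpa using he)
  simpa [Φ'] using this

/-! ### Blaschke products. -/

/-- The Blaschke product with the given zeros. -/
noncomputable def blaschkeProd (R : Multiset ℂ) (z : ℂ) : ℂ :=
  (R.map fun a => (z - a) / (1 - conj a * z)).prod

/-- The two forms differ by the rank-one term `(1 - |a|²) |∑ d i / (1 - conj a * y i)|²`. The
hypothesis says that `szegoSum y d` vanishes at `a`; on such functions the adjoint of multiplication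
by the Blaschke factor is isometric. -/
theorem szegoForm_mul_blaschkeFactor {ι : Type*} [Fintype ι] {y : ι → ℂ} {a : ℂ}
    (hy : ∀ i, y i ∈ unitDisk) (ha : a ∈ unitDisk) (d : ι → ℂ)
    (h : ∑ i, d i / (1 - conj a * y i) = 0) :
    szegoForm y (fun i => d i * ((y i - a) / (1 - conj a * y i))) = szegoForm y d := by
  simp only [unitDisk, mem_ball_zero_iff] at hy ha
  have h1 : ∑ i, ∑ j, (1 - a * conj a) *
      ((d i / (1 - conj a * y i)) * conj (d j / (1 - conj a * y j))) = 0 := by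
    simp only [← Finset.mul_sum]
    simp only [← Finset.sum_mul, h]
    simp
  rw [eq_comm, ← sub_eq_zero, szegoForm, szegoForm, ← Complex.sub_re, ← Complex.zero_re, ← h1,
    ← Finset.sum_sub_distrib]
  congr 1
  refine Finset.sum_congr rfl fun i _ => ?_
  rw [← Finset.sum_sub_distrib]
  refine Finset.sum_congr rfl fun j _ => ?_
  have n1 := one_sub_conj_mul_ne_zero ha (hy i).le
  have n2 := one_sub_conj_mul_ne_zero ha (hy j).le
  have n3 : 1 - a * conj (y j) ≠ 0 := by
    have := (map_ne_zero (starRingEnd ℂ)).2 n2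
    simpa using this
  have n4 : 1 - y i * conj (y j) ≠ 0 := by
    have := one_sub_conj_mul_ne_zero (hy j) (hy i).le
    rwa [mul_comm] at this
  simp only [map_mul, map_div₀, map_sub, map_one, Complex.conj_conj]
  clear n2 h1
  generalize conj a = a' at n1 ⊢
  generalize conj (y j) = w at n3 n4 ⊢
  generalize conj (d j) = e
  generalize hu : 1 - a' * y i = u at n1 ⊢
  generalize ht : 1 - a * w = t at n3 ⊢
  generalize hs : 1 - y i * w = s at n4 ⊢
  field_simp
  subst hu ht hs
  ring

/-- One condition per zero. The conditions for the remaining factors are imposed on the vector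
already multiplied by the first one, so repeated zeros need no derivatives. -/
theorem exists_linearMap_szegoForm_mul_blaschkeProd {ι : Type*} [Fintype ι] {y : ι → ℂ}
    (hy : ∀ i, y i ∈ unitDisk) (R : Multiset ℂ) (hR : ∀ a ∈ R, a ∈ unitDisk) :
    ∃ L : (ι → ℂ) →ₗ[ℂ] (Fin R.card → ℂ), ∀ d, L d = 0 →
      szegoForm y (fun i => d i * blaschkeProd R (y i)) = szegoForm y d := by
  induction R using Multiset.induction_on with
  | empty => exact ⟨0, fun d _ => by simp [blaschkeProd]⟩
  | cons a R ih =>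
    obtain ⟨L, hL⟩ := ih fun b hb => hR b (Multiset.mem_cons_of_mem hb)
    rw [Multiset.card_cons]
    let b : ι → ℂ := fun i => (y i - a) / (1 - conj a * y i)
    let l0 : (ι → ℂ) →ₗ[ℂ] ℂ :=
      ∑ i, (1 - conj a * y i)⁻¹ • (LinearMap.proj i : (ι → ℂ) →ₗ[ℂ] ℂ)
    let L' : (ι → ℂ) →ₗ[ℂ] (Fin R.card → ℂ) := L ∘ₗ LinearMap.mulRight ℂ b
    refine ⟨LinearMap.pi (Fin.cons l0 fun k => LinearMap.proj k ∘ₗ L'), fun d hd => ?_⟩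
    have h0 : ∑ i, d i / (1 - conj a * y i) = 0 := by
      have := congrFun hd 0
      simpa [l0, LinearMap.sum_apply, div_eq_inv_mul] using this
    have h1 : L (d * b) = 0 := by
      ext k
      have := congrFun hd k.succ
      simpa [L'] using this
    rw [← szegoForm_mul_blaschkeFactor hy (hR a (Multiset.mem_cons_self a R)) d h0]
    have h2 := hL _ h1
    simpa [blaschkeProd, b, mul_assoc, Pi.mul_def] using h2

open Classical in
/-- The zeros in the disk, listed with multiplicities. -/
noncomputable def diskRoots (B : RatFunc ℂ) : Multiset ℂ := B.num.roots.filter fun z => z ∈ unitDisk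

theorem mem_unitDisk_of_mem_diskRoots {B : RatFunc ℂ} {a : ℂ} (h : a ∈ diskRoots B) :
    a ∈ unitDisk := by
  classical
  exact (Multiset.mem_filter.1 h).2

theorem ratVal_eq (B : RatFunc ℂ) (z : ℂ) : ratVal B z = B.num.eval z / B.denom.eval z := by
  simp [ratVal, RatFunc.eval, Polynomial.eval₂_eq_eval_map]

theorem IsBlaschke.num_ne_zero {B : RatFunc ℂ} (hB : IsBlaschke B) : B.num ≠ 0 := by
  intro h
  have := hB.2 1 (by simp)
  simp [ratVal_eq, h] at this

theorem IsBlaschke.denom_eval_ne_zero {B : RatFunc ℂ} (hB : IsBlaschke B) {z : ℂ} (hz : ‖z‖ ≤ 1) :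
    B.denom.eval z ≠ 0 := by
  rcases hz.lt_or_eq with h | h
  · exact hB.1 z (by simpa [unitDisk] using h)
  -- At a pole on the circle `ratVal` takes the default value `0`, which is not unimodular.
  · intro h0
    have := hB.2 z h
    simp [ratVal_eq, h0] at this

open Polynomial in
theorem IsBlaschke.exists_num_eq {B : RatFunc ℂ} (hB : IsBlaschke B) :
    ∃ n : ℂ[X], B.num = ((diskRoots B).map fun a => X - C a).prod * n ∧
      ∀ z, ‖z‖ ≤ 1 → n.eval z ≠ 0 := by
  classical
  obtain ⟨n, hn⟩ : ((diskRoots B).map fun a => X - C a).prod ∣ B.num :=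
    (Multiset.prod_X_sub_C_dvd_iff_le_roots hB.num_ne_zero _).2 (Multiset.filter_le _ _)
  refine ⟨n, hn, fun z hz h0 => ?_⟩
  have hne : ((diskRoots B).map fun a => X - C a).prod * n ≠ 0 := hn ▸ hB.num_ne_zero
  rcases hz.lt_or_eq with h | h
  · have hr : B.num.roots = diskRoots B + n.roots := by
      conv_lhs => rw [hn, roots_mul hne, roots_multiset_prod_X_sub_C]
    have hn0 : n ≠ 0 := right_ne_zero_of_mul hne
    have h1 : 0 < n.roots.count z := Multiset.count_pos.2 ((mem_roots hn0).2 h0)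
    have h2 : (diskRoots B).count z = B.num.roots.count z :=
      Multiset.count_filter_of_pos (by simpa [unitDisk] using h)
    have h3 := congrArg (Multiset.count z) hr
    rw [Multiset.count_add] at h3
    omega
  · have := hB.2 z h
    rw [ratVal_eq, hn, eval_mul, h0] at this
    simp at this

theorem norm_blaschkeFactor {a z : ℂ} (ha : a ∈ unitDisk) (hz : ‖z‖ = 1) :
    ‖(z - a) / (1 - conj a * z)‖ = 1 := by
  have n1 := one_sub_conj_mul_ne_zero (by simpa [unitDisk] using ha) hz.le
  have h4 : z * conj z = 1 := by
    rw [Complex.mul_conj, Complex.normSq_eq_norm_sq, hz]; simp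
  have h1 : 1 - conj a * z = z * conj (z - a) := by
    rw [map_sub, mul_sub, h4]; ring
  have h2 : ‖1 - conj a * z‖ = ‖z - a‖ := by
    rw [h1, norm_mul, hz, RCLike.norm_conj, one_mul]
  rw [norm_div, h2, div_self]
  rw [← h2]
  exact norm_ne_zero_iff.2 n1

theorem norm_blaschkeProd {R : Multiset ℂ} (hR : ∀ a ∈ R, a ∈ unitDisk) {z : ℂ} (hz : ‖z‖ = 1) :
    ‖blaschkeProd R z‖ = 1 := by
  induction R using Multiset.induction_on with
  | empty => simp [blaschkeProd]
  | cons a R ih =>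
    have h1 := ih fun b hb => hR b (Multiset.mem_cons_of_mem hb)
    rw [blaschkeProd] at h1 ⊢
    rw [Multiset.map_cons, Multiset.prod_cons, norm_mul, h1, mul_one,
      norm_blaschkeFactor (hR a (Multiset.mem_cons_self a R)) hz]

open Polynomial in
-- The quotient `v` has no zeros in the disk and is unimodular on the circle, so the maximum
-- principle gives `‖v‖ ≤ 1`. That `v` is constant is not needed: it is absorbed into the Schur
-- function `S * v`.
theorem IsBlaschke.exists_blaschkeProd_eq {B : RatFunc ℂ} (hB : IsBlaschke B) :
    ∃ v : ℂ → ℂ, AnalyticOnNhd ℂ v unitDisk ∧ (∀ z ∈ unitDisk, ‖v z‖ ≤ 1) ∧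
      ∀ z ∈ unitDisk, v z ≠ 0 ∧ blaschkeProd (diskRoots B) z = v z * ratVal B z := by
  obtain ⟨n, hn, hn0⟩ := hB.exists_num_eq
  set D : ℂ[X] := ((diskRoots B).map fun a => 1 - C (conj a) * X).prod with hD
  have hDe : ∀ z, D.eval z = ((diskRoots B).map fun a => 1 - conj a * z).prod := by
    intro z
    rw [hD, eval_multiset_prod, Multiset.map_map]
    simp
  have hNe : ∀ z, B.num.eval z = ((diskRoots B).map fun a => z - a).prod * n.eval z := by
    intro z
    rw [hn, eval_mul, eval_multiset_prod, Multiset.map_map]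
    simp
  have hD0 : ∀ z, ‖z‖ ≤ 1 → D.eval z ≠ 0 := by
    intro z hz
    rw [hDe]
    refine Multiset.prod_ne_zero ?_
    simp only [Multiset.mem_map, not_exists, not_and]
    intro a ha
    exact one_sub_conj_mul_ne_zero
      (by simpa [unitDisk] using mem_unitDisk_of_mem_diskRoots ha) hz
  have hbl : ∀ z, blaschkeProd (diskRoots B) z =
      ((diskRoots B).map fun a => z - a).prod / D.eval z := by
    intro z
    rw [hDe, blaschkeProd, Multiset.prod_map_div]
  set v : ℂ → ℂ := fun z => B.denom.eval z / (n.eval z * D.eval z) with hv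
  have hvb : ∀ z, ‖z‖ ≤ 1 → blaschkeProd (diskRoots B) z = v z * ratVal B z := by
    intro z hz
    have h1 := hn0 z hz
    have h2 := hD0 z hz
    have h3 := hB.denom_eval_ne_zero hz
    rw [hbl, hv, ratVal_eq, hNe]
    field_simp
  have hdiff : ∀ z, ‖z‖ ≤ 1 → AnalyticAt ℂ v z := by
    intro z hz
    have ha : ∀ p : ℂ[X], AnalyticAt ℂ (fun z => p.eval z) z := fun p =>
      AnalyticOnNhd.eval_polynomial p z (mem_univ z)
    exact (ha _).div ((ha _).mul (ha _)) (mul_ne_zero (hn0 z hz) (hD0 z hz))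
  refine ⟨v, fun z hz => hdiff z (by simpa [unitDisk] using (mem_ball.1 hz).le), fun z hz => ?_,
    fun z hz => ?_⟩
  · refine Complex.norm_le_of_forall_mem_frontier_norm_le (isBounded_ball (x := (0 : ℂ)) (r := 1))
      ?_ ?_ (subset_closure hz)
    · refine DifferentiableOn.diffContOnCl fun ζ hζ => ?_
      rw [closure_ball (0 : ℂ) one_ne_zero, mem_closedBall_zero_iff] at hζ
      exact (hdiff ζ hζ).differentiableAt.differentiableWithinAt
    · intro ζ hζ
      rw [frontier_ball (0 : ℂ) one_ne_zero, mem_sphere_zero_iff_norm] at hζ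
      have h1 := congrArg norm (hvb ζ hζ.le)
      rw [norm_mul, hB.2 ζ hζ, mul_one, norm_blaschkeProd (fun a ha => mem_unitDisk_of_mem_diskRoots ha) hζ] at h1
      exact h1.ge
  · have hz' : ‖z‖ ≤ 1 := by simpa [unitDisk] using (mem_ball.1 hz).le
    exact ⟨div_ne_zero (hB.denom_eval_ne_zero hz') (mul_ne_zero (hn0 z hz') (hD0 z hz')),
      hvb z hz'⟩

/-! ### The upper bound for the number of negative squares. -/

theorem IsStandard.pickNeg_le {q ℓ : ℕ} {W : Finset ℂ} {f S : ℂ → ℂ} {B : RatFunc ℂ}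
    {z γ : Fin ℓ → ℂ} (hf : IsStandard q ℓ W f S B z γ) {n : ℕ} {y : Fin n → ℂ}
    (hinj : Function.Injective y) (hy : ∀ i, y i ∈ dom (W : Set ℂ)) : pickNeg f y ≤ q + ℓ := by
  classical
  have hyd : ∀ i, y i ∈ unitDisk := fun i => (hy i).1
  obtain ⟨v, hva, hv1, hvb⟩ := hf.blaschke.exists_blaschkeProd_eq
  obtain ⟨L, hL⟩ := exists_linearMap_szegoForm_mul_blaschkeProd hyd (diskRoots B)
    fun a ha => mem_unitDisk_of_mem_diskRoots ha
  set b : Fin n → ℂ := fun i => blaschkeProd (diskRoots B) (y i) with hb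
  have hcard : (diskRoots B).card = q := hf.degree
  let L2 : (Fin n → ℂ) →ₗ[ℂ] (Fin ℓ → ℂ) := LinearMap.pi fun j =>
    ∑ i, if y i = z j then (LinearMap.proj i : (Fin n → ℂ) →ₗ[ℂ] ℂ) else 0
  -- These are the `q` conditions on `c / b` and the `ℓ` conditions `c i = 0` at jumps. Where `b`
  -- vanishes `b⁻¹` is `0`; this happens only at jumps, where `c` vanishes too.
  let L3 : (Fin n → ℂ) →ₗ[ℂ] (Fin (diskRoots B).card ⊕ Fin ℓ → ℂ) :=
    LinearMap.pi (Sum.elim (fun k => LinearMap.proj k ∘ₗ L ∘ₗ LinearMap.mulRight ℂ b⁻¹)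
      (fun j => LinearMap.proj j ∘ₗ L2))
  have hSv : IsSchur fun x => S x * v x := by
    refine ⟨hf.schur.1.mul hva, fun x hx => ?_⟩
    rw [norm_mul]
    exact mul_le_one₀ (hf.schur.2 x hx) (norm_nonneg _) (hv1 x hx)
  have := pickNeg_le_of_nonneg_on_ker f y L3 fun c hc => ?_
  · simpa [hcard] using this
  have hc1 : L (c * b⁻¹) = 0 := by
    ext k
    simpa [L3] using congrFun hc (Sum.inl k)
  have hc2 : ∀ i, y i ∈ range z → c i = 0 := by
    rintro i ⟨j, hj⟩
    have h1 := congrFun hc (Sum.inr j)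
    have h2 : ∑ k, (if y k = z j then c k else 0) = 0 := by
      rw [← show L3 c (Sum.inr j) = ∑ k, (if y k = z j then c k else 0) by
        simp only [L3, L2, LinearMap.pi_apply, Sum.elim_inr, LinearMap.comp_apply,
          LinearMap.proj_apply, LinearMap.sum_apply]
        refine Finset.sum_congr rfl fun k _ => ?_
        split_ifs <;> simp]
      exact h1
    rw [Finset.sum_eq_single i] at h2
    · simpa [hj] using h2
    · intro k _ hk
      rw [if_neg]
      rw [hj]
      exact fun h => hk (hinj h)
    · simp
  have hB0 : ∀ i, y i ∉ range z → ratVal B (y i) ≠ 0 := by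
    intro i hi h0
    rcases hf.zeros_subset ⟨hyd i, h0⟩ with h | h
    · exact (hy i).2 h
    · exact hi h
  set d : Fin n → ℂ := c * b⁻¹ with hd
  have e1 : c = fun i => d i * b i := by
    ext i
    by_cases hi : y i ∈ range z
    · simp [hd, hc2 i hi]
    · have hbi : b i ≠ 0 := by
        rw [hb]
        simp only [(hvb (y i) (hyd i)).2]
        exact mul_ne_zero (hvb (y i) (hyd i)).1 (hB0 i hi)
      simp [hd, hbi]
  have e2 : (fun i => c i * f (y i)) = fun i => d i * (S (y i) * v (y i)) := by
    ext i
    by_cases hi : y i ∈ range z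
    · simp [hd, hc2 i hi]
    · rw [hf.eq_quotient (y i) (hyd i) (by rintro (h | h); exacts [(hy i).2 h, hi h])]
      rw [congrFun e1 i]
      simp only [hb, (hvb (y i) (hyd i)).2]
      field_simp [hB0 i hi]
  calc szegoForm y (fun i => c i * f (y i)) = szegoForm y (fun i => d i * (S (y i) * v (y i))) := by
        rw [e2]
    _ ≤ szegoForm y d := hSv.szegoForm_mul_le d hyd
    _ = szegoForm y (fun i => d i * b i) := (hL d hc1).symm
    _ = szegoForm y c := by rw [← e1]

/-! ### Interpolation estimates uniform in the nodes. -/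

theorem differentiableOn_dslope_unitDisk {g : ℂ → ℂ} (hg : DifferentiableOn ℂ g unitDisk) {w : ℂ}
    (hw : w ∈ unitDisk) : DifferentiableOn ℂ (dslope g w) unitDisk :=
  (Complex.differentiableOn_dslope (isOpen_ball.mem_nhds hw)).2 hg

theorem closedBall_subset_unitDisk {ρ : ℝ} (hρ : ρ < 1) : closedBall (0 : ℂ) ρ ⊆ unitDisk :=
  closedBall_subset_ball hρ

theorem norm_le_of_norm_le_on_sphere {g : ℂ → ℂ} (hg : DifferentiableOn ℂ g unitDisk) {ρ K : ℝ}
    (h0 : 0 < ρ) (h1 : ρ < 1) (h : ∀ z, ‖z‖ = ρ → ‖g z‖ ≤ K) {z : ℂ} (hz : ‖z‖ ≤ ρ) :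
    ‖g z‖ ≤ K := by
  refine Complex.norm_le_of_forall_mem_frontier_norm_le (isBounded_ball (x := (0 : ℂ)) (r := ρ))
    (DifferentiableOn.diffContOnCl ?_) ?_ (z := z) ?_
  · rw [closure_ball (0 : ℂ) h0.ne']
    exact hg.mono (closedBall_subset_unitDisk h1)
  · intro ζ hζ
    rw [frontier_ball (0 : ℂ) h0.ne', mem_sphere_zero_iff_norm] at hζ
    exact h ζ hζ
  · rw [closure_ball (0 : ℂ) h0.ne']
    simpa using hz

/-- The maximum principle moves the estimate to `‖ζ‖ = ρ`, where `‖ζ - w‖ ≥ ρ - ρ'`; hence no loss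
as `z` approaches `w`. -/
theorem norm_dslope_le {g : ℂ → ℂ} (hg : DifferentiableOn ℂ g unitDisk) {ρ' ρ K : ℝ}
    (h0 : 0 < ρ) (h01 : ρ' < ρ) (h1 : ρ < 1) (h : ∀ z, ‖z‖ ≤ ρ → ‖g z‖ ≤ K) {w : ℂ}
    (hw : ‖w‖ ≤ ρ') {z : ℂ} (hz : ‖z‖ ≤ ρ) : ‖dslope g w z‖ ≤ 2 / (ρ - ρ') * K := by
  have hwd : w ∈ unitDisk := by rw [unitDisk, mem_ball_zero_iff]; linarith
  refine norm_le_of_norm_le_on_sphere (differentiableOn_dslope_unitDisk hg hwd) h0 h1 ?_ hz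
  intro ζ hζ
  have h2 : ρ - ρ' ≤ ‖ζ - w‖ := by
    have := norm_sub_norm_le ζ w
    linarith
  have h3 : 0 < ρ - ρ' := by linarith
  have hne : ζ ≠ w := by
    rintro rfl
    simp at h2
    linarith
  rw [dslope_of_ne _ hne, slope_def_module, norm_smul, norm_inv]
  have h4 : ‖g ζ - g w‖ ≤ 2 * K := by
    have := norm_sub_le (g ζ) (g w)
    linarith [h ζ hζ.le, h w (by linarith)]
  have h5 : 0 ≤ 2 * K := (norm_nonneg _).trans h4
  calc ‖ζ - w‖⁻¹ * ‖g ζ - g w‖ ≤ (ρ - ρ')⁻¹ * (2 * K) := by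
        gcongr
    _ = 2 / (ρ - ρ') * K := by ring

/-- Newton interpolation by divided differences: write `g` as `g w + (z - w) * dslope g w z` and
interpolate the slope at the other nodes. The constant depends only on the radii and the number of
nodes, not on their separation. -/
theorem exists_interpolation_bound {ρ' ρ : ℝ} (h0 : 0 < ρ) (h01 : ρ' < ρ) (h1 : ρ < 1) (m : ℕ) :
    ∃ C : ℝ, 0 ≤ C ∧ ∀ (s : Finset ℂ), s.card = m → (∀ w ∈ s, ‖w‖ ≤ ρ') →
      ∀ (g : ℂ → ℂ) (K : ℝ), 0 ≤ K → DifferentiableOn ℂ g unitDisk →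
        (∀ z, ‖z‖ ≤ ρ → ‖g z‖ ≤ K) →
        ∃ c : ℕ → ℂ, (∀ i, ‖c i‖ ≤ C * K) ∧ (∀ i, m ≤ i → c i = 0) ∧
          ∀ w ∈ s, g w = ∑ i ∈ Finset.range m, c i * w ^ i := by
  induction m with
  | zero =>
    refine ⟨0, le_rfl, fun s hs _ g K _ _ _ => ⟨0, by simp, by simp, ?_⟩⟩
    rw [Finset.card_eq_zero] at hs
    simp [hs]
  | succ m ih =>
    obtain ⟨C, hC, ih⟩ := ih
    have hρ : 0 < ρ - ρ' := by linarith
    refine ⟨1 + 2 * (C * (2 / (ρ - ρ'))), by positivity, ?_⟩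
    intro s hs hsρ g K hK hg hgK
    obtain ⟨w, s', hw, rfl, hs'⟩ := Finset.card_eq_succ.1 hs
    have hwρ := hsρ w (Finset.mem_insert_self w s')
    have hwd : w ∈ unitDisk := by rw [unitDisk, mem_ball_zero_iff]; linarith
    obtain ⟨c, hc1, hc2, hc3⟩ := ih s' hs' (fun v hv => hsρ v (Finset.mem_insert_of_mem hv))
      (dslope g w) (2 / (ρ - ρ') * K) (by positivity) (differentiableOn_dslope_unitDisk hg hwd)
      fun z hz => norm_dslope_le hg h0 h01 h1 hgK hwρ hz
    refine ⟨fun i => (if i = 0 then g w else c (i - 1)) - w * c i, ?_, ?_, ?_⟩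
    · intro i
      have e1 : ‖w * c i‖ ≤ C * (2 / (ρ - ρ') * K) := by
        rw [norm_mul]
        calc ‖w‖ * ‖c i‖ ≤ 1 * ‖c i‖ := by gcongr; linarith
          _ ≤ _ := by rw [one_mul]; exact hc1 i
      have e2 : ‖(if i = 0 then g w else c (i - 1))‖ ≤ K + C * (2 / (ρ - ρ') * K) := by
        have e3 : 0 ≤ C * (2 / (ρ - ρ') * K) := by positivity
        split_ifs
        · linarith [hgK w (by linarith)]
        · linarith [hc1 (i - 1)]
      refine (norm_sub_le _ _).trans ?_
      linarith
    · intro i hi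
      beta_reduce
      rw [if_neg (by omega), hc2 _ (by omega), hc2 _ (by omega)]
      simp
    · intro v hv
      have e1 : ∑ i ∈ Finset.range (m + 1), ((if i = 0 then g w else c (i - 1)) - w * c i) * v ^ i =
          g w + (v - w) * ∑ i ∈ Finset.range m, c i * v ^ i := by
        have e2 : ∑ i ∈ Finset.range (m + 1), (if i = 0 then g w else c (i - 1)) * v ^ i =
            g w + v * ∑ i ∈ Finset.range m, c i * v ^ i := by
          rw [Finset.sum_range_succ', Finset.mul_sum]
          simp only [Nat.add_eq_zero_iff, one_ne_zero, and_false, if_false, Nat.add_sub_cancel,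
            if_true, pow_zero, mul_one, pow_succ]
          rw [add_comm]
          congr 1
          exact Finset.sum_congr rfl fun i _ => by ring
        have e3 : ∑ i ∈ Finset.range (m + 1), w * c i * v ^ i =
            w * ∑ i ∈ Finset.range m, c i * v ^ i := by
          rw [Finset.sum_range_succ, hc2 m le_rfl, Finset.mul_sum]
          simp [mul_assoc]
        simp only [sub_mul, Finset.sum_sub_distrib]
        rw [e2, e3]
        ring
      rw [e1]
      rcases Finset.mem_insert.1 hv with rfl | hv
      · simp
      · rw [← hc3 v hv, ← smul_eq_mul, sub_smul_dslope]
        ring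

/-- The first moments of `e` control all its pairings with analytic functions, with a constant that
survives coalescing nodes. -/
theorem exists_norm_sum_mul_le {ρ' ρ : ℝ} (h0 : 0 < ρ) (h01 : ρ' < ρ) (h1 : ρ < 1)
    (A : Type*) [Fintype A] :
    ∃ C : ℝ, 0 ≤ C ∧ ∀ x : A → ℂ, Function.Injective x → (∀ a, ‖x a‖ ≤ ρ') →
      ∀ (e : A → ℂ) (g : ℂ → ℂ) (K : ℝ), 0 ≤ K → DifferentiableOn ℂ g unitDisk →
        (∀ z, ‖z‖ ≤ ρ → ‖g z‖ ≤ K) →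
        ‖∑ a, e a * g (x a)‖ ≤
          C * K * ∑ i ∈ Finset.range (Fintype.card A), ‖∑ a, e a * x a ^ i‖ := by
  classical
  obtain ⟨C, hC, H⟩ := exists_interpolation_bound h0 h01 h1 (Fintype.card A)
  refine ⟨C, hC, fun x hx hxρ e g K hK hg hgK => ?_⟩
  obtain ⟨c, hc1, -, hc3⟩ := H (Finset.univ.image x)
    (by rw [Finset.card_image_of_injective _ hx, Finset.card_univ]) (by simpa using hxρ) g K hK hg hgK
  have e1 : ∑ a, e a * g (x a) =
      ∑ i ∈ Finset.range (Fintype.card A), c i * ∑ a, e a * x a ^ i := by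
    simp only [Finset.mul_sum]
    rw [Finset.sum_comm]
    refine Finset.sum_congr rfl fun a _ => ?_
    rw [hc3 (x a) (by simp), Finset.mul_sum]
    exact Finset.sum_congr rfl fun i _ => by ring
  rw [e1, Finset.mul_sum]
  refine (norm_sum_le _ _).trans (Finset.sum_le_sum fun i _ => ?_)
  rw [norm_mul]
  gcongr
  exact hc1 i

open Polynomial in
theorem eval_multiset_prod_X_sub_C (l : Multiset ℂ) (z : ℂ) :
    ((l.map fun a => X - C a).prod).eval z = (l.map fun a => z - a).prod := by
  rw [eval_multiset_prod, Multiset.map_map]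
  simp

theorem multiset_prod_sub_eq_zero_iff {l : Multiset ℂ} {z : ℂ} :
    (l.map fun a => z - a).prod = 0 ↔ z ∈ l := by
  simp [Multiset.prod_eq_zero_iff, sub_eq_zero]

open Polynomial in
-- The congruence `S P ≡ F` modulo `∏ (z - a)` is solved one node at a time, adding `τ` times the
-- product over the previous nodes. If `S a ≠ 0`, divisibility determines `τ` and the value at `a`
-- is automatic. If `S a = 0`, then `a` is a new node and divisibility holds for every `τ`, so `τ`
-- is free to prescribe `P a`.
theorem exists_polynomial_mul_eq {S F : ℂ → ℂ} (hS : DifferentiableOn ℂ S unitDisk)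
    (hF : DifferentiableOn ℂ F unitDisk) (t : ℂ → ℂ) (l : Multiset ℂ)
    (hl : ∀ a ∈ l, a ∈ unitDisk ∧ S a * t a = F a) (hc : ∀ a, S a = 0 → l.count a ≤ 1) :
    ∃ (P : ℂ[X]) (v : ℂ → ℂ), DifferentiableOn ℂ v unitDisk ∧
      (∀ z ∈ unitDisk, S z * P.eval z = F z + (l.map fun a => z - a).prod * v z) ∧
      ∀ a ∈ l, P.eval a = t a := by
  induction l using Multiset.induction_on with
  | empty => exact ⟨0, -F, hF.neg, by simp, by simp⟩
  | cons a l ih =>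
    obtain ⟨P, v, hv, hP, hPt⟩ := ih (fun b hb => hl b (Multiset.mem_cons_of_mem hb))
      fun b hb => (Multiset.count_le_count_cons b a l).trans (hc b hb)
    obtain ⟨ha, hSt⟩ := hl a (Multiset.mem_cons_self a l)
    have hPa := hP a ha
    obtain ⟨τ, hτ1, hτ2⟩ : ∃ τ : ℂ, v a + τ * S a = 0 ∧
        P.eval a + τ * (l.map fun b => a - b).prod = t a := by
      by_cases hSa : S a = 0
      · have hal : a ∉ l := by
          intro hal
          have h1 := hc a hSa
          rw [Multiset.count_cons_self] at h1
          have h2 := Multiset.count_pos.2 hal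
          omega
        have hp : (l.map fun b => a - b).prod ≠ 0 := fun h =>
          hal (multiset_prod_sub_eq_zero_iff.1 h)
        refine ⟨(t a - P.eval a) / (l.map fun b => a - b).prod, ?_, ?_⟩
        · rw [hSa, mul_zero, add_zero]
          rw [hSa, zero_mul] at hSt hPa
          rw [← hSt, zero_add] at hPa
          exact (mul_eq_zero.1 hPa.symm).resolve_left hp
        · field_simp
          ring
      · refine ⟨-v a / S a, by field_simp; ring, ?_⟩
        refine mul_left_cancel₀ hSa ?_
        rw [mul_add, hPa, hSt]
        field_simp
        ring
    have hd : DifferentiableOn ℂ (fun z => v z + τ * S z) unitDisk := hv.add (hS.const_mul τ)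
    refine ⟨P + C τ * (l.map fun a => X - C a).prod, dslope (fun z => v z + τ * S z) a,
      differentiableOn_dslope_unitDisk hd ha, fun z hz => ?_, fun b hb => ?_⟩
    · have h1 := sub_smul_dslope (fun z => v z + τ * S z) a z
      rw [hτ1, sub_zero, smul_eq_mul] at h1
      rw [eval_add, eval_mul, eval_C, eval_multiset_prod_X_sub_C, Multiset.map_cons,
        Multiset.prod_cons]
      linear_combination hP z hz - (l.map fun b => z - b).prod * h1
    · rw [eval_add, eval_mul, eval_C, eval_multiset_prod_X_sub_C]
      rcases Multiset.mem_cons.1 hb with rfl | hb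
      · exact hτ2
      · rw [multiset_prod_sub_eq_zero_iff.2 hb, mul_zero, add_zero, hPt b hb]

theorem eventually_norm_prod_sub_prod_le {A : Type*} [Fintype A] (a : A → ℂ) {δ : ℝ} (hδ : 0 < δ) :
    ∀ᶠ x : A → ℂ in 𝓝 a, ∀ z : ℂ, ‖z‖ ≤ 1 →
      ‖∏ i, (z - a i) - ∏ i, (z - x i)‖ ≤ δ := by
  have h := (isCompact_closedBall (0 : ℂ) 1).eventually_forall_of_forall_eventually (x₀ := a)
    (P := fun x z => ‖∏ i, (z - a i) - ∏ i, (z - x i)‖ ≤ δ) ?_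
  · simpa using h
  · intro z _
    have hc : ContinuousAt (fun p : (A → ℂ) × ℂ => ‖∏ i, (p.2 - a i) - ∏ i, (p.2 - p.1 i)‖)
        (a, z) := by fun_prop
    have h1 : ‖∏ i, (z - a i) - ∏ i, (z - a i)‖ < δ := by simpa using hδ
    filter_upwards [hc.eventually_lt continuousAt_const h1] with p hp using hp.le

theorem exists_norm_le_of_differentiableOn {g : ℂ → ℂ} (hg : DifferentiableOn ℂ g unitDisk) {ρ : ℝ}
    (hρ : ρ < 1) : ∃ K : ℝ, 0 ≤ K ∧ ∀ z, ‖z‖ ≤ ρ → ‖g z‖ ≤ K := by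
  obtain ⟨K, hK⟩ := (isCompact_closedBall (0 : ℂ) ρ).exists_bound_of_continuousOn
    (hg.continuousOn.mono (closedBall_subset_unitDisk hρ))
  exact ⟨max K 0, le_max_right _ _, fun z hz =>
    (hK z (by simpa using hz)).trans (le_max_left _ _)⟩

/-! ### Lagrange interpolation at the jumps. -/

/-- The Lagrange basis polynomials, as functions. -/
noncomputable def lagrangeFun {ι : Type*} [Fintype ι] (z : ι → ℂ) (j : ι) (x : ℂ) : ℂ := by
  classical exact (Lagrange.basis Finset.univ z j).eval x

open Classical in
theorem lagrangeFun_apply_node {ι : Type*} [Fintype ι] {z : ι → ℂ} (hz : Function.Injective z)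
    (j k : ι) : lagrangeFun z j (z k) = if j = k then 1 else 0 := by
  split_ifs with h
  · subst h
    exact Lagrange.eval_basis_self hz.injOn (Finset.mem_univ _)
  · exact Lagrange.eval_basis_of_ne h (Finset.mem_univ _)

theorem differentiable_lagrangeFun {ι : Type*} [Fintype ι] (z : ι → ℂ) (j : ι) :
    Differentiable ℂ (lagrangeFun z j) := Polynomial.differentiable _

open Polynomial in
/-- Uniform bounds for the quotients of `x ^ k` minus its Lagrange interpolant by the node
polynomial. -/
theorem exists_lagrange_quotient_bound {ι : Type*} [Fintype ι] {z : ι → ℂ}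
    (hz : Function.Injective z) {ρ' ρ : ℝ} (h0 : 0 < ρ) (h01 : ρ' < ρ) (h1 : ρ < 1)
    (hzρ : ∀ j, ‖z j‖ ≤ ρ') :
    ∃ C : ℝ, 0 ≤ C ∧ ∀ k : ℕ, ∃ Q : ℂ[X], (∀ x, ‖x‖ ≤ ρ → ‖Q.eval x‖ ≤ C * ρ ^ k) ∧
      ∀ x, x ^ k - ∑ j, z j ^ k * lagrangeFun z j x = (∏ j, (x - z j)) * Q.eval x := by
  classical
  have hb : ∀ j, ∃ K : ℝ, 0 ≤ K ∧ ∀ x, ‖x‖ ≤ ρ → ‖lagrangeFun z j x‖ ≤ K := fun j =>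
    exists_norm_le_of_differentiableOn (differentiable_lagrangeFun z j).differentiableOn h1
  choose K hK0 hK using hb
  have hρ : 0 < ρ - ρ' := by linarith
  refine ⟨(1 + ∑ j, K j) / (ρ - ρ') ^ Fintype.card ι, ?_, fun k => ?_⟩
  · have := Finset.sum_nonneg fun j (_ : j ∈ Finset.univ) => hK0 j
    positivity
  set p : ℂ[X] := X ^ k - ∑ j, C (z j ^ k) * Lagrange.basis Finset.univ z j with hp
  have hpe : ∀ x, p.eval x = x ^ k - ∑ j, z j ^ k * lagrangeFun z j x := by
    intro x
    simp [hp, eval_finsetSum, lagrangeFun]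
  have hdvd : ∏ j, (X - C (z j)) ∣ p := by
    refine Finset.prod_dvd_of_coprime ?_ ?_
    · intro i _ j _ hij
      exact pairwise_coprime_X_sub_C hz hij
    · intro j _
      rw [dvd_iff_isRoot, IsRoot, hpe]
      simp [lagrangeFun_apply_node hz]
  obtain ⟨Q, hQ⟩ := hdvd
  have hQe : ∀ x, x ^ k - ∑ j, z j ^ k * lagrangeFun z j x = (∏ j, (x - z j)) * Q.eval x := by
    intro x
    rw [← hpe, hQ, eval_mul, eval_prod]
    simp
  refine ⟨Q, fun x hx => norm_le_of_norm_le_on_sphere Q.differentiable.differentiableOn h0 h1 ?_ hx,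
    hQe⟩
  intro ζ hζ
  have e1 : (ρ - ρ') ^ Fintype.card ι ≤ ‖∏ j, (ζ - z j)‖ := by
    rw [norm_prod, ← Finset.card_univ, ← Finset.prod_const]
    refine Finset.prod_le_prod (fun _ _ => hρ.le) fun j _ => ?_
    have := norm_sub_norm_le ζ (z j)
    linarith [hzρ j]
  have e2 : ‖ζ ^ k - ∑ j, z j ^ k * lagrangeFun z j ζ‖ ≤ (1 + ∑ j, K j) * ρ ^ k := by
    refine (norm_sub_le _ _).trans ?_
    rw [add_mul, one_mul, norm_pow, hζ, Finset.sum_mul]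
    gcongr
    refine (norm_sum_le _ _).trans (Finset.sum_le_sum fun j _ => ?_)
    rw [norm_mul, norm_pow, mul_comm (K j)]
    gcongr
    · linarith [hzρ j]
    · exact hK j ζ hζ.le
  rw [hQe, norm_mul] at e2
  rw [div_mul_eq_mul_div, le_div_iff₀ (by positivity), mul_comm]
  refine le_trans ?_ e2
  gcongr

/-! ### The form for nodes near the jumps and the poles. -/

theorem differentiableOn_nodeDefect_mul {A : Type*} [Fintype A] (a x : A → ℂ) {u : ℂ → ℂ}
    (hu : DifferentiableOn ℂ u unitDisk) :
    DifferentiableOn ℂ (fun w => (∏ i, (w - a i) - ∏ i, (w - x i)) * u w) unitDisk := by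
  refine DifferentiableOn.mul (Differentiable.differentiableOn ?_) hu
  fun_prop

/-- A combination of values at nodes close to the zeros of `∏ (w - a i)` of a multiple of this
product is small. -/
theorem exists_norm_sum_prod_mul_le {ρ' ρ : ℝ} (h0 : 0 < ρ) (h01 : ρ' < ρ) (h1 : ρ < 1)
    {A : Type*} [Fintype A] (a : A → ℂ) :
    ∃ C : ℝ, 0 ≤ C ∧ ∀ x : A → ℂ, Function.Injective x → (∀ i, ‖x i‖ ≤ ρ') → ∀ δ : ℝ, 0 ≤ δ →
      (∀ w : ℂ, ‖w‖ ≤ 1 → ‖∏ i, (w - a i) - ∏ i, (w - x i)‖ ≤ δ) →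
      ∀ (e : A → ℂ) (u : ℂ → ℂ) (K : ℝ), 0 ≤ K → DifferentiableOn ℂ u unitDisk →
        (∀ w, ‖w‖ ≤ ρ → ‖u w‖ ≤ K) →
        ‖∑ b, e b * ((∏ i, (x b - a i)) * u (x b))‖ ≤
          C * δ * K * ∑ i ∈ Finset.range (Fintype.card A), ‖∑ b, e b * x b ^ i‖ := by
  obtain ⟨C, hC, H⟩ := exists_norm_sum_mul_le h0 h01 h1 A
  refine ⟨C, hC, fun x hx hxρ δ hδ hxδ e u K hK hu huK => ?_⟩
  -- The product `∏ (w - x i)` vanishes at every node, so subtracting it changes nothing there and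
  -- leaves a factor of size `δ`.
  have h2 := H x hx hxρ e _ (δ * K) (by positivity) (differentiableOn_nodeDefect_mul a x hu)
    fun w hw => by
      rw [norm_mul]
      have := hxδ w (by linarith)
      have := huK w hw
      gcongr
  have h3 : ∀ b, ∏ i, (x b - x i) = 0 := fun b =>
    Finset.prod_eq_zero (Finset.mem_univ b) (sub_self _)
  simp only [h3, sub_zero] at h2
  rwa [mul_assoc C δ K]

/-- The coefficients at the jumps that compensate for the coefficients at the nodes. -/
noncomputable def jumpCoeff {ι A : Type*} [Fintype ι] [Fintype A] (z : ι → ℂ) (β : ℂ → ℂ) (x e : A → ℂ) (j : ι) :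
    ℂ := -∑ b, e b * β (x b) * lagrangeFun z j (x b)

theorem prod_sub_eq_of_map_eq {ι A : Type*} [Fintype ι] [Fintype A] {z : ι → ℂ} {R : Multiset ℂ}
    {a : A → ℂ} (ha : Finset.univ.val.map a = Finset.univ.val.map z + R) (w : ℂ) :
    ∏ i, (w - a i) = (∏ j, (w - z j)) * (R.map fun b => w - b).prod := by
  have := congrArg (fun l : Multiset ℂ => (l.map fun b => w - b).prod) ha
  rw [Multiset.map_add, Multiset.prod_add, Multiset.map_map, Multiset.map_map] at this
  exact this

/-- The interpolation error of `x ^ k` contains `∏ (x - z j)` and `β` contains the product over `R`;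
together they give `∏ (x - a i)`, nearly zero at the nodes. The factor `ρ ^ k` makes the moments
square summable. -/
theorem exists_norm_sum_small {ι A : Type*} [Fintype ι] [Fintype A] {z : ι → ℂ}
    (hz : Function.Injective z) {R : Multiset ℂ} {E : ℂ → ℂ} (hE : DifferentiableOn ℂ E unitDisk)
    {a : A → ℂ} (ha : Finset.univ.val.map a = Finset.univ.val.map z + R)
    {ρ' ρ : ℝ} (h0 : 0 < ρ) (h01 : ρ' < ρ) (h1 : ρ < 1) (hzρ : ∀ j, ‖z j‖ ≤ ρ')
    {β : ℂ → ℂ} (hβ : ∀ w, β w = (R.map fun b => w - b).prod * E w) :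
    ∃ C : ℝ, 0 ≤ C ∧ ∀ x : A → ℂ, Function.Injective x → (∀ i, ‖x i‖ ≤ ρ') → ∀ δ : ℝ, 0 ≤ δ →
      (∀ w : ℂ, ‖w‖ ≤ 1 → ‖∏ i, (w - a i) - ∏ i, (w - x i)‖ ≤ δ) → ∀ (e : A → ℂ) (k : ℕ),
        ‖∑ j, jumpCoeff z β x e j * z j ^ k + ∑ b, e b * β (x b) * x b ^ k‖ ≤
          C * δ * ρ ^ k * ∑ i ∈ Finset.range (Fintype.card A), ‖∑ b, e b * x b ^ i‖ := by
  obtain ⟨C, hC, H⟩ := exists_norm_sum_prod_mul_le h0 h01 h1 a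
  obtain ⟨C2, hC2, HQ⟩ := exists_lagrange_quotient_bound hz h0 h01 h1 hzρ
  obtain ⟨K, hK, HE⟩ := exists_norm_le_of_differentiableOn hE h1
  refine ⟨C * (K * C2), by positivity, fun x hx hxρ δ hδ hxδ e k => ?_⟩
  obtain ⟨Q, hQ1, hQ2⟩ := HQ k
  have h2 := H x hx hxρ δ hδ hxδ e (fun w => E w * Q.eval w) (K * (C2 * ρ ^ k)) (by positivity)
    (hE.mul Q.differentiable.differentiableOn) fun w hw => by
      rw [norm_mul]
      have := HE w hw
      have := hQ1 w hw
      gcongr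
  have h3 : ∑ j, jumpCoeff z β x e j * z j ^ k + ∑ b, e b * β (x b) * x b ^ k =
      ∑ b, e b * ((∏ i, (x b - a i)) * (E (x b) * Q.eval (x b))) := by
    have h4 : ∑ j, jumpCoeff z β x e j * z j ^ k =
        -∑ b, e b * β (x b) * ∑ j, z j ^ k * lagrangeFun z j (x b) := by
      simp only [jumpCoeff, neg_mul, Finset.sum_neg_distrib, Finset.sum_mul, Finset.mul_sum]
      rw [Finset.sum_comm]
      congr 1
      exact Finset.sum_congr rfl fun b _ => Finset.sum_congr rfl fun j _ => by ring
    rw [h4, neg_add_eq_sub, ← Finset.sum_sub_distrib]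
    refine Finset.sum_congr rfl fun b _ => ?_
    rw [← mul_sub, hQ2, prod_sub_eq_of_map_eq ha, hβ]
    ring
  rw [h3]
  refine h2.trans (le_of_eq ?_)
  ring

open Polynomial in
-- Duality: a polynomial `P` is built whose pairing with the second vector is the `i`-th moment of
-- `e` up to a multiple of `∏ (w - a i)`. That pairing is a fixed finite combination of the power
-- moments bounded by `h`.
theorem exists_norm_moment_le {ι A : Type*} [Fintype ι] [Fintype A] {z : ι → ℂ}
    (hz : Function.Injective z) {R : Multiset ℂ} {E S : ℂ → ℂ}
    (hE : DifferentiableOn ℂ E unitDisk) (hS : DifferentiableOn ℂ S unitDisk)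
    {a : A → ℂ} (ha : Finset.univ.val.map a = Finset.univ.val.map z + R)
    (had : ∀ i, a i ∈ unitDisk)
    {ρ' ρ : ℝ} (h0 : 0 < ρ) (h01 : ρ' < ρ) (h1 : ρ < 1)
    {β : ℂ → ℂ} (hβ : ∀ w, β w = (R.map fun b => w - b).prod * E w) {γ : ι → ℂ}
    (hγ : ∀ j, S (z j) - β (z j) * γ j ≠ 0) (hR : ∀ b ∈ R, S b ≠ 0) (i : ℕ) :
    ∃ M C : ℝ, 0 ≤ M ∧ 0 ≤ C ∧ ∀ x : A → ℂ, Function.Injective x → (∀ i, ‖x i‖ ≤ ρ') →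
      ∀ δ : ℝ, 0 ≤ δ →
      (∀ w : ℂ, ‖w‖ ≤ 1 → ‖∏ i, (w - a i) - ∏ i, (w - x i)‖ ≤ δ) → ∀ (e : A → ℂ) (h : ℝ),
        (∀ k : ℕ, ‖∑ j, jumpCoeff z β x e j * γ j * z j ^ k + ∑ b, e b * S (x b) * x b ^ k‖ ≤ h) →
        ‖∑ b, e b * x b ^ i‖ ≤ M * h +
          C * δ * ∑ i ∈ Finset.range (Fintype.card A), ‖∑ b, e b * x b ^ i‖ := by
  classical
  obtain ⟨C, hC, H⟩ := exists_norm_sum_prod_mul_le h0 h01 h1 a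
  -- The values `τ j = P (z j)` solve `S (z j) τ j = F (z j)`, where `F (z j) = z j ^ i + β (z j) γ
  -- j τ j`. The second term of `F` compensates for the contribution of the jump coefficients.
  set τ : ι → ℂ := fun j => z j ^ i / (S (z j) - β (z j) * γ j) with hτ
  set F : ℂ → ℂ := fun w => w ^ i + β w * ∑ j, γ j * τ j * lagrangeFun z j w with hF
  have hβd : DifferentiableOn ℂ β unitDisk := by
    have : β = fun w => ((R.map fun b => X - Polynomial.C b).prod).eval w * E w := by
      ext w; rw [hβ, eval_multiset_prod_X_sub_C]
    rw [this]
    exact (Polynomial.differentiable _).differentiableOn.mul hE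
  have hFd : DifferentiableOn ℂ F unitDisk := by
    refine DifferentiableOn.add (by fun_prop) (hβd.mul (DifferentiableOn.fun_sum fun j _ => ?_))
    exact ((differentiable_lagrangeFun z j).const_mul _).differentiableOn
  have hmem : ∀ b, b ∈ Finset.univ.val.map a ↔ (∃ j, z j = b) ∨ b ∈ R := by
    intro b; rw [ha]; simp
  obtain ⟨P, v, hv, hP, hPt⟩ := exists_polynomial_mul_eq hS hFd
    (Function.extend z τ fun w => F w / S w) (Finset.univ.val.map a) (by
      intro b hb
      refine ⟨?_, ?_⟩
      · obtain ⟨i, -, rfl⟩ := Multiset.mem_map.1 hb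
        exact had i
      · by_cases hbz : ∃ j, z j = b
        · obtain ⟨j, rfl⟩ := hbz
          rw [hz.extend_apply]
          have h2 : F (z j) = z j ^ i + β (z j) * (γ j * τ j) := by
            simp [hF, lagrangeFun_apply_node hz]
          rw [h2, hτ]
          field_simp [hγ j]
          ring
        · rw [Function.extend_apply' _ _ _ hbz]
          have := hR b (((hmem b).1 hb).resolve_left hbz)
          field_simp) (by
      intro b hb
      have h2 : R.count b = 0 := Multiset.count_eq_zero.2 fun h => hR b h hb
      rw [ha, Multiset.count_add, h2, add_zero]
      exact Multiset.nodup_iff_count_le_one.1 (Finset.univ.nodup.map hz) b)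
  have hPz : ∀ j, P.eval (z j) = τ j := by
    intro j
    rw [hPt _ ((hmem _).2 (Or.inl ⟨j, rfl⟩)), hz.extend_apply]
  obtain ⟨K, hK, HK⟩ := exists_norm_le_of_differentiableOn hv h1
  refine ⟨∑ k ∈ Finset.range (P.natDegree + 1), ‖P.coeff k‖, C * K,
    Finset.sum_nonneg fun _ _ => norm_nonneg _, by positivity, ?_⟩
  intro x hx hxρ δ hδ hxδ e h hh
  have h2 := H x hx hxρ δ hδ hxδ e v K hK hv HK
  have hxd : ∀ b, x b ∈ unitDisk := fun b => by
    rw [unitDisk, mem_ball_zero_iff]; linarith [hxρ b]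
  have h3 : ∑ j, jumpCoeff z β x e j * γ j * P.eval (z j) + ∑ b, e b * S (x b) * P.eval (x b) =
      ∑ b, e b * x b ^ i + ∑ b, e b * ((∏ i, (x b - a i)) * v (x b)) := by
    have h4 : ∑ j, jumpCoeff z β x e j * γ j * P.eval (z j) =
        -∑ b, e b * β (x b) * ∑ j, γ j * τ j * lagrangeFun z j (x b) := by
      simp only [hPz, jumpCoeff, neg_mul, Finset.sum_neg_distrib, Finset.sum_mul, Finset.mul_sum]
      rw [Finset.sum_comm]
      congr 1
      exact Finset.sum_congr rfl fun b _ => Finset.sum_congr rfl fun j _ => by ring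
    rw [h4, neg_add_eq_sub, ← Finset.sum_sub_distrib, ← Finset.sum_add_distrib]
    refine Finset.sum_congr rfl fun b _ => ?_
    have h5 := hP (x b) (hxd b)
    rw [Multiset.map_map] at h5
    have h6 : (Multiset.map ((fun c => x b - c) ∘ a) Finset.univ.val).prod =
      ∏ i, (x b - a i) := rfl
    rw [h6] at h5
    linear_combination e b * h5
  have h4 : ∑ j, jumpCoeff z β x e j * γ j * P.eval (z j) + ∑ b, e b * S (x b) * P.eval (x b) =
      ∑ k ∈ Finset.range (P.natDegree + 1), P.coeff k *
        (∑ j, jumpCoeff z β x e j * γ j * z j ^ k + ∑ b, e b * S (x b) * x b ^ k) := by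
    simp only [mul_add, Finset.sum_add_distrib, eval_eq_sum_range, Finset.mul_sum]
    rw [Finset.sum_comm, Finset.sum_comm (s := Finset.univ (α := A))]
    congr 1 <;>
    exact Finset.sum_congr rfl fun b _ => Finset.sum_congr rfl fun j _ => by ring
  have h5 : ‖∑ j, jumpCoeff z β x e j * γ j * P.eval (z j) + ∑ b, e b * S (x b) * P.eval (x b)‖ ≤
      (∑ k ∈ Finset.range (P.natDegree + 1), ‖P.coeff k‖) * h := by
    rw [h4, Finset.sum_mul]
    refine (norm_sum_le _ _).trans (Finset.sum_le_sum fun k _ => ?_)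
    rw [norm_mul]
    gcongr
    exact hh k
  have h6 : ∑ b, e b * x b ^ i =
      (∑ j, jumpCoeff z β x e j * γ j * P.eval (z j) + ∑ b, e b * S (x b) * P.eval (x b)) -
      ∑ b, e b * ((∏ i, (x b - a i)) * v (x b)) := by rw [h3]; ring
  rw [h6]
  refine (norm_sub_le _ _).trans ?_
  refine add_le_add h5 (h2.trans (le_of_eq (by ring)))

theorem norm_sq_sum_le_szegoForm {ι : Type*} [Fintype ι] {y : ι → ℂ} (g : ι → ℂ)
    (hy : ∀ i, y i ∈ unitDisk) (k : ℕ) : ‖∑ i, g i * y i ^ k‖ ^ 2 ≤ szegoForm y g :=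
  le_hasSum (szegoForm_hasSum y g hy) k fun _ _ => by positivity

theorem szegoForm_le_of_geometric {ι : Type*} [Fintype ι] {y : ι → ℂ} (g : ι → ℂ)
    (hy : ∀ i, y i ∈ unitDisk) {ρ K : ℝ} (h0 : 0 < ρ) (h1 : ρ < 1)
    (h : ∀ k : ℕ, ‖∑ i, g i * y i ^ k‖ ≤ K * ρ ^ k) :
    szegoForm y g ≤ K ^ 2 / (1 - ρ ^ 2) := by
  have h2 := (hasSum_geometric_of_lt_one (r := ρ ^ 2) (by positivity) (by nlinarith)).mul_left
    (K ^ 2)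
  rw [← div_eq_mul_inv] at h2
  refine hasSum_le (fun k => ?_) (szegoForm_hasSum y g hy) h2
  calc ‖∑ i, g i * y i ^ k‖ ^ 2 ≤ (K * ρ ^ k) ^ 2 := by
        gcongr
        exact h k
    _ = K ^ 2 * (ρ ^ 2) ^ k := by ring

theorem exists_pos_lt_one_forall_norm_lt {A : Type*} [Finite A] {a : A → ℂ}
    (ha : ∀ i, a i ∈ unitDisk) : ∃ r : ℝ, 0 < r ∧ r < 1 ∧ ∀ i, ‖a i‖ < r := by
  have h : ∀ᶠ r : ℝ in 𝓝[<] 1, ∀ i, ‖a i‖ < r := by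
    refine Filter.eventually_all.2 fun i => ?_
    have := ha i
    rw [unitDisk, mem_ball_zero_iff] at this
    filter_upwards [Ioo_mem_nhdsLT this] with r hr using hr.1
  obtain ⟨r, hr, hr1⟩ := (h.and (Ioo_mem_nhdsLT (zero_lt_one' ℝ))).exists
  exact ⟨r, hr1.1, hr1.2, hr⟩

/-- Vandermonde nondegeneracy: if the moments vanish, pairing `e` with the Lagrange functions of the
nodes gives `e = 0`. -/
theorem exists_sum_mul_pow_ne_zero {A : Type*} [Fintype A] {x : A → ℂ} (hx : Function.Injective x)
    {e : A → ℂ} (hxd : ∀ i, x i ∈ unitDisk) (he : e ≠ 0) :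
    0 < ∑ i ∈ Finset.range (Fintype.card A), ‖∑ b, e b * x b ^ i‖ := by
  classical
  refine lt_of_le_of_ne (Finset.sum_nonneg fun _ _ => norm_nonneg _) fun h => he ?_
  obtain ⟨r, hr0, hr1, hr⟩ := exists_pos_lt_one_forall_norm_lt hxd
  obtain ⟨ρ, hrρ, hρ1⟩ := exists_between hr1
  obtain ⟨C, hC, H⟩ := exists_norm_sum_mul_le (hr0.trans hrρ) hrρ hρ1 A
  ext b
  have hd := (differentiable_lagrangeFun x b).differentiableOn (s := unitDisk)
  obtain ⟨K, hK, HK⟩ := exists_norm_le_of_differentiableOn hd hρ1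
  have h2 := H x hx (fun i => (hr i).le) e _ K hK hd HK
  rw [← h, mul_zero] at h2
  simpa [lagrangeFun_apply_node hx] using h2

/-- For nodes close to the jumps and the poles there is a space of coefficients, of dimension the
number of nodes, on which the form is negative. -/
theorem eventually_szegoForm_lt {ι A : Type*} [Fintype ι] [Fintype A] {z : ι → ℂ}
    (hz : Function.Injective z) {R : Multiset ℂ} {E S : ℂ → ℂ}
    (hE : DifferentiableOn ℂ E unitDisk) (hS : DifferentiableOn ℂ S unitDisk)
    {a : A → ℂ} (ha : Finset.univ.val.map a = Finset.univ.val.map z + R)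
    (had : ∀ i, a i ∈ unitDisk)
    {β : ℂ → ℂ} (hβ : ∀ w, β w = (R.map fun b => w - b).prod * E w) {γ : ι → ℂ}
    (hγ : ∀ j, S (z j) - β (z j) * γ j ≠ 0) (hR : ∀ b ∈ R, S b ≠ 0) :
    ∀ᶠ x : A → ℂ in 𝓝 a, Function.Injective x → ∀ e : A → ℂ, e ≠ 0 →
      szegoForm (Sum.elim z x) (Sum.elim (jumpCoeff z β x e) fun b => e b * β (x b)) <
        szegoForm (Sum.elim z x)
          (Sum.elim (fun j => jumpCoeff z β x e j * γ j) fun b => e b * S (x b)) := by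
  obtain ⟨ρ', hρ'0, hρ'1, hρ'⟩ := exists_pos_lt_one_forall_norm_lt had
  obtain ⟨ρ, h01, h1⟩ := exists_between hρ'1
  have h0 : 0 < ρ := hρ'0.trans h01
  have hzρ : ∀ j, ‖z j‖ ≤ ρ' := by
    intro j
    have h2 : z j ∈ Finset.univ.val.map a := by rw [ha]; simp
    obtain ⟨i, -, hi⟩ := Multiset.mem_map.1 h2
    rw [← hi]
    exact (hρ' i).le
  obtain ⟨C₁, hC₁, H1⟩ := exists_norm_sum_small hz hE ha h0 h01 h1 hzρ hβ
  choose M C hM hC H2 using exists_norm_moment_le hz hE hS ha had h0 h01 h1 hβ hγ hR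
  set n := Fintype.card A with hn
  set M' := ∑ i ∈ Finset.range n, M i with hM'
  set C' := ∑ i ∈ Finset.range n, C i with hC'
  have hM0 : 0 ≤ M' := Finset.sum_nonneg fun i _ => hM i
  have hC0 : 0 ≤ C' := Finset.sum_nonneg fun i _ => hC i
  have hρ2 : 0 < 1 - ρ ^ 2 := by nlinarith
  -- Chosen so that `C' δ ≤ 1 / 2`, which absorbs the error term in the bound for `N`, and `2 C₁ M'
  -- δ ≤ (1 - ρ²) / 2`, which makes the first form smaller than the second.
  set δ := (1 - ρ ^ 2) / 2 / (1 + C' + 2 * C₁ * M') with hδ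
  have hden : 0 < 1 + C' + 2 * C₁ * M' := by positivity
  have hδ0 : 0 < δ := by positivity
  have hδm : δ * (1 + C' + 2 * C₁ * M') = (1 - ρ ^ 2) / 2 := by
    rw [hδ]; field_simp
  have hCM : 0 ≤ 2 * C₁ * M' := by positivity
  have hδ1 : C' * δ ≤ 1 / 2 := by nlinarith [mul_nonneg hδ0.le hCM, sq_nonneg ρ]
  have hδ2 : 2 * C₁ * M' * δ ≤ (1 - ρ ^ 2) / 2 := by nlinarith [mul_nonneg hδ0.le hC0]
  have hev : ∀ᶠ x : A → ℂ in 𝓝 a, ∀ i, ‖x i‖ < ρ' := by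
    refine Filter.eventually_all.2 fun i => ?_
    have hc : ContinuousAt (fun x : A → ℂ => ‖x i‖) a := (continuous_apply i).norm.continuousAt
    exact hc.eventually_lt continuousAt_const (hρ' i)
  filter_upwards [hev, eventually_norm_prod_sub_prod_le a hδ0] with x hxρ hxδ hx e he
  have hxρ' : ∀ i, ‖x i‖ ≤ ρ' := fun i => (hxρ i).le
  have hxd : ∀ i, x i ∈ unitDisk := fun i => by
    rw [unitDisk, mem_ball_zero_iff]; linarith [hxρ i]
  have hyd : ∀ i, Sum.elim z x i ∈ unitDisk := by
    rintro (j | i)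
    · simp only [Sum.elim_inl, unitDisk, mem_ball_zero_iff]; linarith [hzρ j]
    · exact hxd i
  set N := ∑ i ∈ Finset.range n, ‖∑ b, e b * x b ^ i‖ with hN
  have hN0 : 0 < N := exists_sum_mul_pow_ne_zero hx hxd he
  set H := szegoForm (Sum.elim z x)
    (Sum.elim (fun j => jumpCoeff z β x e j * γ j) fun b => e b * S (x b)) with hH
  have hHk : ∀ k : ℕ, ‖∑ j, jumpCoeff z β x e j * γ j * z j ^ k + ∑ b, e b * S (x b) * x b ^ k‖ ≤
      Real.sqrt H := by
    intro k
    refine Real.le_sqrt_of_sq_le ?_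
    have := norm_sq_sum_le_szegoForm
      (Sum.elim (fun j => jumpCoeff z β x e j * γ j) fun b => e b * S (x b)) hyd k
    simpa [Fintype.sum_sum_type] using this
  have hN1 : N ≤ 2 * M' * Real.sqrt H := by
    have h2 : N ≤ ∑ i ∈ Finset.range n, (M i * Real.sqrt H + C i * δ * N) :=
      Finset.sum_le_sum fun i _ => H2 i x hx hxρ' δ hδ0.le hxδ e _ hHk
    rw [Finset.sum_add_distrib, ← Finset.sum_mul, ← Finset.sum_mul, ← Finset.sum_mul] at h2
    nlinarith
  have hG : szegoForm (Sum.elim z x) (Sum.elim (jumpCoeff z β x e) fun b => e b * β (x b)) ≤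
      (C₁ * δ * N) ^ 2 / (1 - ρ ^ 2) := by
    refine szegoForm_le_of_geometric _ hyd h0 h1 fun k => ?_
    have := H1 x hx hxρ' δ hδ0.le hxδ e k
    rw [Fintype.sum_sum_type]
    simp only [Sum.elim_inl, Sum.elim_inr]
    refine this.trans (le_of_eq ?_)
    ring
  have hs0 : 0 < Real.sqrt H := by
    by_contra hcon
    have h2 : Real.sqrt H = 0 := le_antisymm (not_lt.1 hcon) (Real.sqrt_nonneg _)
    rw [h2, mul_zero] at hN1
    linarith
  have hHs : H = Real.sqrt H ^ 2 := (Real.sq_sqrt (Real.sqrt_pos.1 hs0).le).symm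
  refine hG.trans_lt ?_
  rw [div_lt_iff₀ hρ2]
  have h3 : C₁ * δ * N ≤ (1 - ρ ^ 2) / 2 * Real.sqrt H := by
    calc C₁ * δ * N ≤ C₁ * δ * (2 * M' * Real.sqrt H) := by gcongr
      _ = 2 * C₁ * M' * δ * Real.sqrt H := by ring
      _ ≤ _ := by gcongr
  calc (C₁ * δ * N) ^ 2 ≤ ((1 - ρ ^ 2) / 2 * Real.sqrt H) ^ 2 := by gcongr
    _ = ((1 - ρ ^ 2) / 4) * (Real.sqrt H ^ 2 * (1 - ρ ^ 2)) := by ring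
    _ = ((1 - ρ ^ 2) / 4) * (H * (1 - ρ ^ 2)) := by rw [← hHs]
    _ < 1 * (H * (1 - ρ ^ 2)) := by
        have : 0 < H := Real.sqrt_pos.1 hs0
        have : (1 - ρ ^ 2) / 4 < 1 := by nlinarith [sq_nonneg ρ]
        gcongr
    _ = _ := one_mul _

/-! ### The lower bound for standard functions, with poles listed by multiplicity. -/

theorem szegoForm_comp_equiv {ι κ : Type*} [Fintype ι] [Fintype κ] (σ : ι ≃ κ) (y g : κ → ℂ) :
    szegoForm (y ∘ σ) (g ∘ σ) = szegoForm y g := by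
  unfold szegoForm
  congr 1
  rw [← Equiv.sum_comp σ]
  refine Finset.sum_congr rfl fun i _ => ?_
  rw [← Equiv.sum_comp σ]
  rfl

theorem IsBlaschke.mem_diskRoots_iff {B : RatFunc ℂ} (hB : IsBlaschke B) {b : ℂ} :
    b ∈ diskRoots B ↔ b ∈ diskZeros (ratVal B) := by
  classical
  rw [diskRoots, Multiset.mem_filter, Polynomial.mem_roots hB.num_ne_zero, diskZeros,
    mem_ofPred_eq, and_comm]
  refine and_congr_right fun hb => ?_
  rw [ratVal_eq, div_eq_zero_iff, or_iff_left (hB.1 b hb), Polynomial.IsRoot]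

theorem IsBlaschke.finite_diskZeros {B : RatFunc ℂ} (hB : IsBlaschke B) :
    (diskZeros (ratVal B)).Finite := by
  classical
  refine (diskRoots B).toFinset.finite_toSet.subset fun b hb => ?_
  simpa using hB.mem_diskRoots_iff.2 hb

theorem IsBlaschke.diskRoots_eq_sum {B : RatFunc ℂ} (hB : IsBlaschke B) {k : ℕ} {w : Fin k → ℂ}
    (hw : Function.Injective w) (hwr : range w = diskZeros (ratVal B)) :
    diskRoots B = ∑ j, zeroMult B (w j) • {w j} := by
  classical
  ext b
  rw [Multiset.count_sum']
  simp only [Multiset.count_nsmul, Multiset.count_singleton]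
  by_cases hb : b ∈ range w
  · obtain ⟨j, rfl⟩ := hb
    have hj : w j ∈ diskRoots B := hB.mem_diskRoots_iff.2 (hwr ▸ mem_range_self j)
    rw [Finset.sum_eq_single j (fun i _ hi => by rw [if_neg (hw.ne hi.symm), mul_zero]) (by simp),
      diskRoots, Multiset.count_filter_of_pos (mem_unitDisk_of_mem_diskRoots hj),
      Polynomial.count_roots]
    simp [zeroMult]
  · have hb' : b ∉ diskRoots B := fun h => hb (hwr ▸ hB.mem_diskRoots_iff.1 h)
    rw [Multiset.count_eq_zero_of_notMem hb', Finset.sum_eq_zero]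
    intro j _
    rw [if_neg, mul_zero]
    rintro rfl
    exact hb (mem_range_self j)

/-- The index set of the points near the jumps and near the poles. -/
abbrev NodeIndex (B : RatFunc ℂ) (ℓ : ℕ) {k : ℕ} (w : Fin k → ℂ) : Type :=
  Fin ℓ ⊕ (Σ j : Fin k, Fin (zeroMult B (w j)))

/-- The jumps and the poles, with multiplicities. -/
noncomputable def nodeCenter (B : RatFunc ℂ) {ℓ : ℕ} (z : Fin ℓ → ℂ) {k : ℕ} (w : Fin k → ℂ) :
    NodeIndex B ℓ w → ℂ :=
  Sum.elim z fun p => w p.1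

theorem IsBlaschke.map_nodeCenter {B : RatFunc ℂ} (hB : IsBlaschke B) {ℓ : ℕ} (z : Fin ℓ → ℂ)
    {k : ℕ} {w : Fin k → ℂ} (hw : Function.Injective w) (hwr : range w = diskZeros (ratVal B)) :
    Finset.univ.val.map (nodeCenter B z w) = Finset.univ.val.map z + diskRoots B := by
  have h : ∀ {ι : Type} [Fintype ι] (g : ι → ℂ), Finset.univ.val.map g = ∑ i, {g i} := by
    intro ι _ g
    rw [← Multiset.sum_map_singleton (Finset.univ.val.map g), Multiset.map_map]
    rfl
  rw [h, h, Fintype.sum_sum_type, hB.diskRoots_eq_sum hw hwr, Fintype.sum_sigma]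
  simp [nodeCenter]

theorem IsStandard.card_nodeIndex {q ℓ : ℕ} {W : Finset ℂ} {f S : ℂ → ℂ} {B : RatFunc ℂ}
    {z γ : Fin ℓ → ℂ} (hf : IsStandard q ℓ W f S B z γ) {k : ℕ} {w : Fin k → ℂ}
    (hw : Function.Injective w) (hwr : range w = diskZeros (ratVal B)) :
    Fintype.card (NodeIndex B ℓ w) = q + ℓ := by
  have h := congrArg Multiset.card (hf.blaschke.map_nodeCenter z hw hwr)
  rw [Multiset.card_map, Multiset.card_add, Multiset.card_map] at h
  have hq : (diskRoots B).card = q := hf.degree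
  rw [hq] at h
  simp only [Finset.card_val, Finset.card_univ, Fintype.card_fin] at h
  omega

theorem nodeCenter_mem_unitDisk {q ℓ : ℕ} {W : Finset ℂ} {f S : ℂ → ℂ} {B : RatFunc ℂ}
    {z γ : Fin ℓ → ℂ} (hf : IsStandard q ℓ W f S B z γ) {k : ℕ} {w : Fin k → ℂ}
    (hwr : range w = diskZeros (ratVal B)) (i : NodeIndex B ℓ w) :
    nodeCenter B z w i ∈ unitDisk := by
  rcases i with j | p
  · exact hf.z_mem j
  · have h : w p.1 ∈ diskZeros (ratVal B) := hwr ▸ mem_range_self p.1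
    exact h.1

theorem IsStandard.eventually_le_pickNeg {q ℓ : ℕ} {W : Finset ℂ} {f S : ℂ → ℂ} {B : RatFunc ℂ}
    {z γ : Fin ℓ → ℂ} (hf : IsStandard q ℓ W f S B z γ) {k : ℕ} {w : Fin k → ℂ}
    (hw : Function.Injective w) (hwr : range w = diskZeros (ratVal B)) :
    ∀ᶠ x in 𝓝 (nodeCenter B z w), (∀ i, x i ≠ nodeCenter B z w i) → Function.Injective x →
      (∀ i, x i ∉ range z) ∧
      ∀ (m : ℕ) (y : Fin m → ℂ) (σ : Fin ℓ ⊕ NodeIndex B ℓ w ≃ Fin m),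
        y ∘ σ = Sum.elim z x → (∀ i, y i ∈ dom (W : Set ℂ)) ∧ q + ℓ ≤ pickNeg f y := by
  classical
  obtain ⟨n, hn, hn0⟩ := hf.blaschke.exists_num_eq
  have hdisk : ∀ {x : ℂ}, x ∈ unitDisk → ‖x‖ ≤ 1 := fun hx => by
    simpa [unitDisk] using (mem_ball.1 hx).le
  have hE : DifferentiableOn ℂ (fun x => n.eval x / B.denom.eval x) unitDisk :=
    n.differentiable.differentiableOn.div B.denom.differentiable.differentiableOn fun x hx =>
      hf.blaschke.denom_eval_ne_zero (hdisk hx)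
  have hβ : ∀ x, ratVal B x =
      ((diskRoots B).map fun b => x - b).prod * (n.eval x / B.denom.eval x) := by
    intro x
    rw [ratVal_eq, hn, Polynomial.eval_mul, eval_multiset_prod_X_sub_C, mul_div_assoc]
  have hS0 : ∀ b ∈ diskZeros (ratVal B), S b ≠ 0 := fun b hb h => by
    have : b ∈ diskZeros (ratVal B) ∩ diskZeros S := ⟨hb, hb.1, h⟩
    rw [hf.no_common_zeros] at this
    exact this
  -- At a zero of `B` this is the absence of common zeros; elsewhere it says that the jump is
  -- genuine.
  have hγ : ∀ j, S (z j) - ratVal B (z j) * γ j ≠ 0 := by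
    intro j hj
    by_cases hz : z j ∈ diskZeros (ratVal B)
    · rw [hz.2, zero_mul, sub_zero] at hj
      exact hS0 _ hz hj
    · have hne : ratVal B (z j) ≠ 0 := fun h => hz ⟨hf.z_mem j, h⟩
      refine hf.jump j hz ?_
      rw [div_eq_iff hne]
      linear_combination hj
  have had := nodeCenter_mem_unitDisk hf hwr
  have main := eventually_szegoForm_lt hf.z_inj hE hf.schur.1.differentiableOn
    (hf.blaschke.map_nodeCenter z hw hwr) had hβ hγ
    fun b hb => hS0 b (hf.blaschke.mem_diskRoots_iff.1 hb)
  have hTfin : (range z ∪ diskZeros (ratVal B)).Finite :=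
    (finite_range z).union hf.blaschke.finite_diskZeros
  -- Closeness keeps `x i` away from every jump and pole other than its own center; the center
  -- itself is excluded by the assumption on `x`.
  have hT : ∀ᶠ x in 𝓝 (nodeCenter B z w), ∀ i,
      x i ∉ (range z ∪ diskZeros (ratVal B)) \ {nodeCenter B z w i} := by
    refine Filter.eventually_all.2 fun i => ?_
    have hc : ContinuousAt (fun x : NodeIndex B ℓ w → ℂ => x i) (nodeCenter B z w) :=
      (continuous_apply i).continuousAt
    exact hc.eventually ((hTfin.subset sdiff_subset).isClosed.isOpen_compl.mem_nhds (by simp))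
  have hD : ∀ᶠ x in 𝓝 (nodeCenter B z w), ∀ i, x i ∈ unitDisk :=
    Filter.eventually_all.2 fun i =>
    (continuous_apply (A := fun _ => ℂ) i).continuousAt.eventually
      (isOpen_ball.mem_nhds (had i))
  filter_upwards [main, hT, hD] with x hmain hxT hxD hxne hx
  have hxT' : ∀ i, x i ∉ range z ∪ diskZeros (ratVal B) := fun i hi => hxT i ⟨hi, hxne i⟩
  refine ⟨fun i hi => hxT' i (Or.inl hi), fun m y σ hyσ => ⟨fun i => ?_, ?_⟩⟩
  · obtain ⟨s, rfl⟩ := σ.surjective i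
    have hs := congrFun hyσ s
    rw [Function.comp_apply] at hs
    rw [hs]
    rcases s with j | i
    · exact ⟨hf.z_mem j, fun h => disjoint_left.1 hf.disjoint h (mem_range_self j)⟩
    · exact ⟨hxD i, fun h => hxT' i (Or.inr (hf.W_subset_zeros h))⟩
  -- The coefficients depend linearly on `e`, and multiplying them by `f` cancels `B` at the nodes:
  -- `e b * B (x b) * f (x b) = e b * S (x b)`.
  · let Φ : (NodeIndex B ℓ w → ℂ) →ₗ[ℂ] (Fin m → ℂ) :=
      { toFun := fun e =>
          (Sum.elim (jumpCoeff z (ratVal B) x e) fun b => e b * ratVal B (x b)) ∘ σ.symm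
        map_add' := by
          intro e e'
          ext i
          rcases h : σ.symm i with j | b
          · simp only [Function.comp_apply, Pi.add_apply, h, Sum.elim_inl, jumpCoeff, add_mul,
              Finset.sum_add_distrib]
            ring
          · simp only [Function.comp_apply, Pi.add_apply, h, Sum.elim_inr]
            ring
        map_smul' := by
          intro r e
          ext i
          rcases h : σ.symm i with j | b
          · simp only [Function.comp_apply, Pi.smul_apply, h, Sum.elim_inl, jumpCoeff, smul_eq_mul,
              mul_assoc, ← Finset.mul_sum, RingHom.id_apply]
            ring
          · simp only [Function.comp_apply, Pi.smul_apply, h, Sum.elim_inr, smul_eq_mul,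
              RingHom.id_apply]
            ring }
    rw [← hf.card_nodeIndex hw hwr]
    refine card_le_pickNeg_of_neg f y Φ fun e he => ?_
    rw [← szegoForm_comp_equiv σ, ← szegoForm_comp_equiv σ, hyσ]
    have h1 : Φ e ∘ σ =
        Sum.elim (jumpCoeff z (ratVal B) x e) fun b => e b * ratVal B (x b) := by
      ext s; simp [Φ]
    have h2 : (fun i => Φ e i * f (y i)) ∘ σ =
        Sum.elim (fun j => jumpCoeff z (ratVal B) x e j * γ j) fun b => e b * S (x b) := by
      ext s
      have hs := congrFun hyσ s
      have hs1 := congrFun h1 s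
      rw [Function.comp_apply] at hs hs1
      rw [Function.comp_apply, hs, hs1]
      rcases s with j | b
      · simp [hf.eq_jump]
      · have hb := hxT' b
        have hne : ratVal B (x b) ≠ 0 := fun h => hb (Or.inr ⟨hxD b, h⟩)
        simp only [Sum.elim_inr]
        rw [hf.eq_quotient (x b) (hxD b) (by
          rintro (h | h)
          exacts [hb (Or.inr (hf.W_subset_zeros h)), hb (Or.inl h)])]
        field_simp
    rw [h1, h2]
    exact hmain hx e he

theorem exists_injective_forall_mem_of_infinite {ι : Type*} [Finite ι] {U : ι → Set ℂ}
    (hU : ∀ i, (U i).Infinite) : ∃ x : ι → ℂ, Function.Injective x ∧ ∀ i, x i ∈ U i := by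
  have key : ∀ (n : ℕ) (U : Fin n → Set ℂ), (∀ i, (U i).Infinite) →
      ∃ x : Fin n → ℂ, Function.Injective x ∧ ∀ i, x i ∈ U i := by
    intro n
    induction n with
    | zero => exact fun U _ => ⟨Fin.elim0, fun i => i.elim0, fun i => i.elim0⟩
    | succ n ih =>
      intro U hU
      obtain ⟨x, hx, hxU⟩ := ih (fun i => U i.succ) fun i => hU i.succ
      obtain ⟨u, hu, hux⟩ := (hU 0).exists_notMem_finite (finite_range x)
      refine ⟨Fin.cons u x, Fin.cons_injective_iff.2 ⟨hux, hx⟩, fun i => ?_⟩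
      refine Fin.cases ?_ (fun i => ?_) i
      · simpa using hu
      · simpa using hxU i
  obtain ⟨n, ⟨σ⟩⟩ := Finite.exists_equiv_fin ι
  obtain ⟨x, hx, hxU⟩ := key n (fun i => U (σ.symm i)) fun i => hU _
  exact ⟨x ∘ σ, hx.comp σ.injective, fun i => by simpa using hxU (σ i)⟩

theorem IsStandard.exists_le_pickNeg {q ℓ : ℕ} {W : Finset ℂ} {f S : ℂ → ℂ} {B : RatFunc ℂ}
    {z γ : Fin ℓ → ℂ} (hf : IsStandard q ℓ W f S B z γ) :
    ∃ y : Fin (q + 2 * ℓ) → ℂ, Function.Injective y ∧ (∀ i, y i ∈ dom (W : Set ℂ)) ∧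
      q + ℓ ≤ pickNeg f y := by
  classical
  have hfin := hf.blaschke.finite_diskZeros
  obtain ⟨k, ⟨τ⟩⟩ := @Finite.exists_equiv_fin _ hfin.to_subtype
  set w : Fin k → ℂ := fun j => (τ.symm j : ℂ) with hwdef
  have hw : Function.Injective w := Subtype.val_injective.comp τ.symm.injective
  have hwr : range w = diskZeros (ratVal B) := by
    rw [hwdef, show (fun j => (τ.symm j : ℂ)) = Subtype.val ∘ τ.symm from rfl,
      τ.symm.surjective.range_comp, Subtype.range_coe]
  obtain ⟨ε, hε, H⟩ := Metric.eventually_nhds_iff.1 (hf.eventually_le_pickNeg hw hwr)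
  obtain ⟨x, hx, hxU⟩ := exists_injective_forall_mem_of_infinite
    (U := fun i => ball (nodeCenter B z w i) ε \ {nodeCenter B z w i}) fun i =>
      (infinite_of_mem_nhds _ (ball_mem_nhds _ hε)).sdiff (finite_singleton _)
  obtain ⟨hxz, hxy⟩ := H ((dist_pi_lt_iff hε).2 fun i => (hxU i).1) (fun i => (hxU i).2) hx
  have hcard : Fintype.card (Fin ℓ ⊕ NodeIndex B ℓ w) = q + 2 * ℓ := by
    rw [Fintype.card_sum, hf.card_nodeIndex hw hwr, Fintype.card_fin]
    omega
  let σ := Fintype.equivFinOfCardEq hcard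
  obtain ⟨h1, h2⟩ := hxy _ (Sum.elim z x ∘ σ.symm) σ (by ext; simp)
  refine ⟨_, Function.Injective.comp ?_ σ.symm.injective, h1, h2⟩
  exact hf.z_inj.sumElim hx fun j i h => hxz i ⟨j, h⟩

theorem IsStandard.exists_pickNeg_eq {q ℓ : ℕ} {W : Finset ℂ} {f S : ℂ → ℂ} {B : RatFunc ℂ}
    {z γ : Fin ℓ → ℂ} (hf : IsStandard q ℓ W f S B z γ) :
    ∃ y : Fin (q + 2 * ℓ) → ℂ, Function.Injective y ∧ (∀ i, y i ∈ dom (W : Set ℂ)) ∧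
      pickNeg f y = q + ℓ := by
  obtain ⟨y, hy, hyd, h⟩ := hf.exists_le_pickNeg
  exact ⟨y, hy, hyd, le_antisymm (hf.pickNeg_le hy hyd) h⟩

/-! ### Membership in the class, the order `N(f)`, and the theorem. -/

theorem infinite_dom (W : Finset ℂ) : (dom (W : Set ℂ)).Infinite :=
  (infinite_of_mem_nhds (0 : ℂ) (ball_mem_nhds _ one_pos)).sdiff W.finite_toSet

theorem IsStandard.classS {q ℓ : ℕ} {W : Finset ℂ} {f S : ℂ → ℂ} {B : RatFunc ℂ}
    {z γ : Fin ℓ → ℂ} (hf : IsStandard q ℓ W f S B z γ) : ClassS (q + ℓ) (W : Set ℂ) f where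
  discrete := ⟨hf.W_subset, W.countable_toSet, fun _ _ hx => Set.Infinite.of_accPt hx W.finite_toSet⟩
  le := fun n y hy hyd => hf.pickNeg_le hy hyd
  attained := by
    -- `ClassS` asks for a matrix of positive order; without poles and jumps any one-point matrix
    -- serves, by the upper bound.
    rcases Nat.eq_zero_or_pos (q + 2 * ℓ) with h | h
    · obtain ⟨u, hu⟩ := (infinite_dom W).nonempty
      refine ⟨1, fun _ => u, one_pos, fun i j _ => Subsingleton.elim i j, fun _ => hu, ?_⟩
      have := hf.pickNeg_le (y := fun _ : Fin 1 => u) (fun i j _ => Subsingleton.elim i j)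
        fun _ => hu
      omega
    · obtain ⟨y, hy, hyd, hyk⟩ := hf.exists_pickNeg_eq
      exact ⟨_, y, h, hy, hyd, hyk⟩

theorem maxNeg_le {Λ : Set ℂ} {f : ℂ → ℂ} {n κ : ℕ}
    (h : ∀ y : Fin n → ℂ, Function.Injective y → (∀ i, y i ∈ dom Λ) → pickNeg f y ≤ κ) :
    maxNeg Λ f n ≤ κ := by
  rcases Set.eq_empty_or_nonempty {k : ℕ | ∃ y : Fin n → ℂ, Function.Injective y ∧
    (∀ i, y i ∈ dom Λ) ∧ k = pickNeg f y} with h0 | h0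
  · rw [maxNeg, h0]
    simp
  · refine csSup_le h0 ?_
    rintro _ ⟨y, hy, hyd, rfl⟩
    exact h y hy hyd

theorem pickNeg_le_maxNeg {Λ : Set ℂ} {f : ℂ → ℂ} {n : ℕ} {y : Fin n → ℂ}
    (hy : Function.Injective y) (hyd : ∀ i, y i ∈ dom Λ) : pickNeg f y ≤ maxNeg Λ f n := by
  refine le_csSup ⟨n, ?_⟩ ⟨y, hy, hyd, rfl⟩
  rintro _ ⟨y, -, -, rfl⟩
  exact negEig_le_card _

theorem IsStandard.maxNeg_eq {q ℓ : ℕ} {W : Finset ℂ} {f S : ℂ → ℂ} {B : RatFunc ℂ}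
    {z γ : Fin ℓ → ℂ} (hf : IsStandard q ℓ W f S B z γ) :
    maxNeg (W : Set ℂ) f (q + 2 * ℓ) = q + ℓ := by
  obtain ⟨y, hy, hyd, h⟩ := hf.exists_pickNeg_eq
  exact le_antisymm (maxNeg_le fun y hy hyd => hf.pickNeg_le hy hyd)
    (h ▸ pickNeg_le_maxNeg hy hyd)

theorem exists_equiv_comp_eq {ι : Type*} [Fintype ι] {m : ℕ} {y : Fin m → ℂ}
    (hy : Function.Injective y) {t : ι → ℂ} (h : range y = range t) (hc : Fintype.card ι = m) :
    ∃ σ : ι ≃ Fin m, y ∘ σ = t := by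
  have h1 : ∀ s, ∃ i, y i = t s := fun s => by
    have : t s ∈ range y := h ▸ mem_range_self s
    exact this
  choose σ hσ using h1
  have hs : Function.Surjective σ := fun i => by
    have : y i ∈ range t := h ▸ mem_range_self i
    obtain ⟨s, hs⟩ := this
    exact ⟨s, hy ((hσ s).trans hs)⟩
  exact ⟨Equiv.ofBijective σ ((Fintype.bijective_iff_surjective_and_card σ).2 ⟨hs, by simpa⟩),
    funext hσ⟩

theorem theoremT (q ℓ : ℕ) (W : Finset ℂ) (f S : ℂ → ℂ) (B : RatFunc ℂ) (z γ : Fin ℓ → ℂ)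
    (hf : IsStandard q ℓ W f S B z γ) :
    ClassS (q + ℓ) (W : Set ℂ) f ∧
    (maxNeg (W : Set ℂ) f (minOrder (q + ℓ) (W : Set ℂ) f) = q + ℓ ∧
      q + ℓ ≤ minOrder (q + ℓ) (W : Set ℂ) f ∧
      minOrder (q + ℓ) (W : Set ℂ) f ≤ q + 2 * ℓ) ∧
    (∀ (k : ℕ) (w : Fin k → ℂ), Function.Injective w → Set.range w = diskZeros (ratVal B) →
      ∃ ε : ℝ, 0 < ε ∧
        ∀ (y : Fin (q + 2 * ℓ) → ℂ) (ν : Fin ℓ → ℂ) (M : Fin k → Finset ℂ),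
          Function.Injective y →
          Set.range y = Set.range z ∪ Set.range ν ∪ ⋃ j, (M j : Set ℂ) →
          (∀ j, ν j ∉ Set.range z ∧ dist (ν j) (z j) < ε) →
          (∀ j, (M j).card = zeroMult B (w j) ∧
            ∀ μ ∈ M j, 0 < dist μ (w j) ∧ dist μ (w j) < ε) →
          (∀ i, y i ∈ dom (W : Set ℂ)) ∧ pickNeg f y = q + ℓ) := by
  have hmem : q + 2 * ℓ ∈ {n : ℕ | maxNeg (W : Set ℂ) f n = q + ℓ} := hf.maxNeg_eq
  have hmin : maxNeg (W : Set ℂ) f (minOrder (q + ℓ) (W : Set ℂ) f) = q + ℓ :=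
    Nat.sInf_mem ⟨_, hmem⟩
  refine ⟨hf.classS, ⟨hmin, ?_, Nat.sInf_le hmem⟩, fun k w hw hwr => ?_⟩
  · conv_lhs => rw [← hmin]
    exact maxNeg_le fun y _ _ => negEig_le_card _
  -- Balls in the product space are for the sup metric, so a neighborhood of the list of centers
  -- yields a single `ε` for all nodes.
  · obtain ⟨ε, hε, H⟩ := Metric.eventually_nhds_iff.1 (hf.eventually_le_pickNeg hw hwr)
    refine ⟨ε, hε, fun y ν M hy hyr hν hM => ?_⟩
    let x : NodeIndex B ℓ w → ℂ :=
      Sum.elim ν fun p => (((M p.1).equivFinOfCardEq (hM p.1).1).symm p.2 : ℂ)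
    have hMr : range (fun p : (Σ j : Fin k, Fin (zeroMult B (w j))) =>
        (((M p.1).equivFinOfCardEq (hM p.1).1).symm p.2 : ℂ)) = ⋃ j, (M j : Set ℂ) := by
      ext u
      simp only [mem_range, mem_iUnion, Sigma.exists]
      refine exists_congr fun j => ⟨?_, fun hu => ?_⟩
      · rintro ⟨i, rfl⟩
        exact Subtype.prop _
      · exact ⟨(M j).equivFinOfCardEq (hM j).1 ⟨u, hu⟩, by simp⟩
    have hcard : Fintype.card (Fin ℓ ⊕ NodeIndex B ℓ w) = q + 2 * ℓ := by
      rw [Fintype.card_sum, hf.card_nodeIndex hw hwr, Fintype.card_fin]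
      omega
    obtain ⟨σ, hσ⟩ := exists_equiv_comp_eq (t := Sum.elim z x) hy
      (by rw [Sum.elim_range, Sum.elim_range, hMr, hyr, union_assoc]) hcard
    have hinj : Function.Injective (Sum.elim z x) := hσ ▸ hy.comp σ.injective
    have hx : Function.Injective x := hinj.comp Sum.inr_injective
    have hxd : ∀ i, x i ≠ nodeCenter B z w i ∧ dist (x i) (nodeCenter B z w i) < ε := by
      rintro (j | p)
      · exact ⟨fun h => (hν j).1 ⟨j, h.symm⟩, (hν j).2⟩
      · have h := (hM p.1).2 _ (((M p.1).equivFinOfCardEq (hM p.1).1).symm p.2).2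
        exact ⟨dist_pos.1 h.1, h.2⟩
    obtain ⟨-, h⟩ := H ((dist_pi_lt_iff hε).2 fun i => (hxd i).2) (fun i => (hxd i).1) hx
    obtain ⟨h1, h2⟩ := h _ y σ hσ
    exact ⟨h1, le_antisymm (hf.pickNeg_le hy h1) h2⟩
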